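/- Let $M$ be a smooth, Hausdorff, second countable, connected manifold of dimension $n\ge 1$. Let $\mathcal D^1(M)=C^\infty(M)\oplus\mathrm{Vect}(M)$ be the Lie algebra, under the commutator, of linear differential operators of order at most one on $C^\infty(M)$, where $X+f$ denotes the operator $g\mapsto X(g)+fg$. Fix a smooth nowhere vanishing $1$-density $|\eta|$ on $M$ and let $\operatorname{div}X\in C^\infty(M)$ be the divergence of a vector field $X$, defined by $L_X|\eta|=(\operatorname{div}X)\,|\eta|$. Then a map $C:\mathcal D^1(M)\to\mathcal D^1(M)$ is a derivation of the (real) Lie algebra $\mathcal D^1(M)$ if and only if it can be written in the form $$C(X+f)=[Y,X+f]+\kappa f+\lambda\operatorname{div}X+\omega(X)\qquad (X\in\mathrm{Vect}(M),\ f\in C^\infty(M)),$$ where $Y\in\mathrm{Vect}(M)$, $\kappa,\lambda\in\mathbb R$, and $\omega$ is a closed smooth $1$-form on $M$. Every such choice of $(Y,\kappa,\lambda,\omega)$ defines such a map, and $Y,\kappa,\lambda,\omega$ are uniquely determined by $C$. -/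

import Mathlib

/-!
First-order differential operators on a smooth manifold: functions, vector fields, one-forms,
densities, the divergence attached to a density, and the Lie algebra of operators of order at
most one. Manifolds are modelled on `EuclideanSpace ℝ (Fin n)`; smooth means `C^∞`.
-/

open scoped Manifold ContDiff Bundle Topology
open VectorField

-- associative algebras are Lie algebras under the commutator bracket
attribute [local instance 100] LieRing.ofAssociativeRing

/-- `C^∞(M)`, the real algebra of smooth functions on `M`. -/
abbrev SmoothFun (n : ℕ) (M : Type*) [TopologicalSpace M]
    [ChartedSpace (EuclideanSpace ℝ (Fin n)) M] : Type _ :=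
  C^∞⟮𝓡 n, M; ℝ⟯

/-- `Vect(M)`, the smooth sections of the tangent bundle. -/
abbrev SmoothVectorField (n : ℕ) (M : Type*) [TopologicalSpace M]
    [ChartedSpace (EuclideanSpace ℝ (Fin n)) M] [IsManifold (𝓡 n) ∞ M] : Type _ :=
  Cₛ^∞⟮𝓡 n; EuclideanSpace ℝ (Fin n), (TangentSpace (𝓡 n) : M → Type _)⟯

/-- `Ω¹(M)`, the smooth sections of the cotangent bundle. -/
abbrev SmoothOneForm (n : ℕ) (M : Type*) [TopologicalSpace M]
    [ChartedSpace (EuclideanSpace ℝ (Fin n)) M] [IsManifold (𝓡 n) ∞ M] : Type _ :=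
  Cₛ^∞⟮𝓡 n; EuclideanSpace ℝ (Fin n) →L[ℝ] ℝ,
    (fun x : M => TangentSpace (𝓡 n) x →L[ℝ] Bundle.Trivial M ℝ x)⟯

section euclid
variable {n : ℕ}
local notation "𝔼" => EuclideanSpace ℝ (Fin n)

theorem det_differentiable : Differentiable ℝ
    (fun T : EuclideanSpace ℝ (Fin n) →L[ℝ] EuclideanSpace ℝ (Fin n) =>
      LinearMap.det (T : EuclideanSpace ℝ (Fin n) →ₗ[ℝ] EuclideanSpace ℝ (Fin n))) := by
  have : (fun T : EuclideanSpace ℝ (Fin n) →L[ℝ] EuclideanSpace ℝ (Fin n) =>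
      LinearMap.det (T : EuclideanSpace ℝ (Fin n) →ₗ[ℝ] EuclideanSpace ℝ (Fin n))) =
    fun T => ∑ s : Equiv.Perm (Fin n), ((Equiv.Perm.sign s : ℤ) : ℝ) *
      ∏ i, (T (EuclideanSpace.basisFun (Fin n) ℝ i)) (s i) := by
    ext T
    rw [← LinearMap.det_toMatrix (EuclideanSpace.basisFun (Fin n) ℝ).toBasis, Matrix.det_apply']
    simp [LinearMap.toMatrix_apply]
  rw [this]
  fun_prop

theorem fderiv_det (A : 𝔼 ≃L[ℝ] 𝔼) (H : 𝔼 →L[ℝ] 𝔼) :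
    fderiv ℝ (fun T : 𝔼 →L[ℝ] 𝔼 => LinearMap.det (T : 𝔼 →ₗ[ℝ] 𝔼)) (A : 𝔼 →L[ℝ] 𝔼) H =
      LinearMap.det ((A : 𝔼 →L[ℝ] 𝔼) : 𝔼 →ₗ[ℝ] 𝔼) *
        LinearMap.trace ℝ 𝔼 (((A.symm : 𝔼 →L[ℝ] 𝔼) ∘L H : 𝔼 →L[ℝ] 𝔼) : 𝔼 →ₗ[ℝ] 𝔼) := by
  set K : 𝔼 →ₗ[ℝ] 𝔼 := (((A.symm : 𝔼 →L[ℝ] 𝔼) ∘L H : 𝔼 →L[ℝ] 𝔼) : 𝔼 →ₗ[ℝ] 𝔼) with hK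
  have h1 : HasDerivAt (fun t : ℝ => LinearMap.det
      (((A : 𝔼 →L[ℝ] 𝔼) + t • H : 𝔼 →L[ℝ] 𝔼) : 𝔼 →ₗ[ℝ] 𝔼))
      (fderiv ℝ (fun T : 𝔼 →L[ℝ] 𝔼 => LinearMap.det (T : 𝔼 →ₗ[ℝ] 𝔼)) (A : 𝔼 →L[ℝ] 𝔼) H) 0 := by
    have := (det_differentiable (n := n) ((A : 𝔼 →L[ℝ] 𝔼) + (0:ℝ) • H)).hasFDerivAt.comp_hasDerivAt (0:ℝ)
      (((hasDerivAt_id (0:ℝ)).smul_const H).const_add (A : 𝔼 →L[ℝ] 𝔼))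
    have h0 : (A : 𝔼 →L[ℝ] 𝔼) + (0:ℝ) • H = A := by rw [zero_smul ℝ H, add_zero]
    rw [h0, one_smul] at this
    exact this
  have h2 : HasDerivAt (fun t : ℝ => LinearMap.det
      (((A : 𝔼 →L[ℝ] 𝔼) + t • H : 𝔼 →L[ℝ] 𝔼) : 𝔼 →ₗ[ℝ] 𝔼))
      (LinearMap.det ((A : 𝔼 →L[ℝ] 𝔼) : 𝔼 →ₗ[ℝ] 𝔼) * LinearMap.trace ℝ 𝔼 K) 0 := by
    have e : ∀ t : ℝ, LinearMap.det
      (((A : 𝔼 →L[ℝ] 𝔼) + t • H : 𝔼 →L[ℝ] 𝔼) : 𝔼 →ₗ[ℝ] 𝔼) =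
      LinearMap.det ((A : 𝔼 →L[ℝ] 𝔼) : 𝔼 →ₗ[ℝ] 𝔼) *
        (1 + t • (LinearMap.toMatrix (EuclideanSpace.basisFun (Fin n) ℝ).toBasis
          (EuclideanSpace.basisFun (Fin n) ℝ).toBasis K)).det := by
      intro t
      have : (((A : 𝔼 →L[ℝ] 𝔼) + t • H : 𝔼 →L[ℝ] 𝔼) : 𝔼 →ₗ[ℝ] 𝔼) =
          ((A : 𝔼 →L[ℝ] 𝔼) : 𝔼 →ₗ[ℝ] 𝔼) * (1 + t • K) := by
        ext v
        simp [hK]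
      rw [this, map_mul, ← LinearMap.det_toMatrix (EuclideanSpace.basisFun (Fin n) ℝ).toBasis (1 + t • K)]
      simp [map_add, LinearMap.toMatrix_one]
    simp only [e]
    simp_rw [fun (t : ℝ) (N : Matrix (Fin n) (Fin n) ℝ) => Matrix.det_one_add_smul t N]
    rw [LinearMap.trace_eq_matrix_trace ℝ (EuclideanSpace.basisFun (Fin n) ℝ).toBasis]
    set N := LinearMap.toMatrix (EuclideanSpace.basisFun (Fin n) ℝ).toBasis
          (EuclideanSpace.basisFun (Fin n) ℝ).toBasis K
    apply HasDerivAt.const_mul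
    set P := (Matrix.det (1 + (Polynomial.X : Polynomial ℝ) • N.map Polynomial.C)).divX.divX
    have h3 : HasDerivAt (fun t : ℝ => 1 + N.trace * t + P.eval t * t ^ 2)
      (N.trace * 1 + (P.derivative.eval 0 * 0 ^ 2 + P.eval 0 * (2 * 0 ^ (2-1)))) 0 := by
      have := (((hasDerivAt_id (0:ℝ)).const_mul N.trace).const_add 1).add ((P.hasDerivAt 0).mul (hasDerivAt_pow 2 (0:ℝ)))
      simpa using! this
    simp only [mul_one, mul_zero, zero_pow, ne_eq, OfNat.ofNat_ne_zero, not_false_eq_true,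
      pow_one, Nat.add_one_sub_one, add_zero] at h3
    simpa using h3
  exact h1.unique h2

/-- The coefficient of the Lie derivative `L_X η = (∑ i, ∂_i (r X^i)) |dx¹ ⋯ dxⁿ|` of the density
`η = r |dx¹ ⋯ dxⁿ|` on an open subset of Euclidean space. -/
noncomputable def lieDerivCoeff (r : 𝔼 → ℝ) (X : 𝔼 → 𝔼) (y : 𝔼) : ℝ :=
  ∑ i, fderiv ℝ (fun z => r z * X z i) y (EuclideanSpace.basisFun (Fin n) ℝ i)

theorem lieDerivCoeff_eq {r : 𝔼 → ℝ} {X : 𝔼 → 𝔼} {y : 𝔼} (hr : DifferentiableAt ℝ r y)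
    (hX : DifferentiableAt ℝ X y) :
    lieDerivCoeff r X y = fderiv ℝ r y (X y) + r y * LinearMap.trace ℝ 𝔼 (fderiv ℝ X y : 𝔼 →ₗ[ℝ] 𝔼) := by
  have h : ∀ i, fderiv ℝ (fun z => r z * X z i) y (EuclideanSpace.basisFun (Fin n) ℝ i) =
      r y * (fderiv ℝ X y (EuclideanSpace.basisFun (Fin n) ℝ i)) i +
        X y i * fderiv ℝ r y (EuclideanSpace.basisFun (Fin n) ℝ i) := by
    intro i
    have h1 : HasFDerivAt (fun z => X z i) ((EuclideanSpace.proj i : 𝔼 →L[ℝ] ℝ) ∘L fderiv ℝ X y) y :=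
      (EuclideanSpace.proj i : 𝔼 →L[ℝ] ℝ).hasFDerivAt.comp y hX.hasFDerivAt
    rw [show fderiv ℝ (fun z => r z * X z i) y = _ from (hr.hasFDerivAt.mul h1).fderiv]
    simp
  rw [lieDerivCoeff, Finset.sum_congr rfl (fun i _ => h i), Finset.sum_add_distrib, add_comm]
  congr 1
  · conv_rhs => rw [← (EuclideanSpace.basisFun (Fin n) ℝ).sum_repr (X y)]
    simp
  · rw [LinearMap.trace_eq_matrix_trace ℝ (EuclideanSpace.basisFun (Fin n) ℝ).toBasis, ← Finset.mul_sum]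
    simp [Matrix.trace, LinearMap.toMatrix_apply]

theorem lieDerivCoeff_change {τ : 𝔼 → 𝔼} {y : 𝔼} (hτ : ContDiffAt ℝ 2 τ y)
    (A : 𝔼 ≃L[ℝ] 𝔼) (hA : fderiv ℝ τ y = A) {r₁ r₂ : 𝔼 → ℝ} {X₁ X₂ : 𝔼 → 𝔼}
    (hr : r₁ =ᶠ[𝓝 y] fun z => |LinearMap.det (fderiv ℝ τ z : 𝔼 →ₗ[ℝ] 𝔼)| * r₂ (τ z))
    (hX : (fun z => X₂ (τ z)) =ᶠ[𝓝 y] fun z => fderiv ℝ τ z (X₁ z))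
    (hr₂ : DifferentiableAt ℝ r₂ (τ y)) (hX₁ : DifferentiableAt ℝ X₁ y)
    (hX₂ : DifferentiableAt ℝ X₂ (τ y)) :
    lieDerivCoeff r₁ X₁ y = |LinearMap.det (fderiv ℝ τ y : 𝔼 →ₗ[ℝ] 𝔼)| * lieDerivCoeff r₂ X₂ (τ y) := by
  have hτ1 : HasFDerivAt τ (A : 𝔼 →L[ℝ] 𝔼) y := hA ▸ (hτ.differentiableAt two_ne_zero).hasFDerivAt
  set B := fderiv ℝ (fderiv ℝ τ) y with hB
  have hD : HasFDerivAt (fderiv ℝ τ) B y :=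
    ((hτ.fderiv_right (m := 1) (by norm_num)).differentiableAt one_ne_zero).hasFDerivAt
  have hsymm : ∀ u v, B u v = B v u := fun u v =>
    (hτ.isSymmSndFDerivAt (by simp)).eq u v
  set d : ℝ := LinearMap.det ((A : 𝔼 →L[ℝ] 𝔼) : 𝔼 →ₗ[ℝ] 𝔼) with hd
  have hd0 : d ≠ 0 := by
    have : d = LinearMap.det (A.toLinearEquiv : 𝔼 →ₗ[ℝ] 𝔼) := rfl
    rw [this]; exact (LinearEquiv.isUnit_det' A.toLinearEquiv).ne_zero
  -- derivative of det
  have hdet : HasFDerivAt (fun z => LinearMap.det (fderiv ℝ τ z : 𝔼 →ₗ[ℝ] 𝔼))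
      ((fderiv ℝ (fun T : 𝔼 →L[ℝ] 𝔼 => LinearMap.det (T : 𝔼 →ₗ[ℝ] 𝔼)) (A : 𝔼 →L[ℝ] 𝔼)) ∘L B) y := by
    have := (det_differentiable (n := n) (fderiv ℝ τ y)).hasFDerivAt.comp y hD
    rwa [hA] at this
  have habs : HasDerivAt (fun t : ℝ => |t|) (SignType.sign d : ℝ) d := hasDerivAt_abs hd0
  have hdy : LinearMap.det (fderiv ℝ τ y : 𝔼 →ₗ[ℝ] 𝔼) = d := by rw [hA]
  have hdet' := (show HasDerivAt (fun t : ℝ => |t|) (SignType.sign d : ℝ)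
    (LinearMap.det (fderiv ℝ τ y : 𝔼 →ₗ[ℝ] 𝔼)) from hdy ▸ habs).comp_hasFDerivAt y hdet
  have hρ := hdet'.mul (hr₂.hasFDerivAt.comp y hτ1)
  have hρ1 := hρ.congr_of_eventuallyEq hr
  have hXX := (hX₂.hasFDerivAt.comp y hτ1).unique
    ((hD.clm_apply hX₁.hasFDerivAt).congr_of_eventuallyEq hX)
  have hXy : X₂ (τ y) = A (X₁ y) := by
    have := hX.self_of_nhds
    simpa [hA] using this
  have hry : r₁ y = |d| * r₂ (τ y) := by
    rw [← hdy]; exact hr.self_of_nhds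
  rw [lieDerivCoeff_eq hρ1.differentiableAt hX₁, lieDerivCoeff_eq hr₂ hX₂, hρ1.fderiv]
  have htr : LinearMap.trace ℝ 𝔼 (fderiv ℝ X₂ (τ y) : 𝔼 →ₗ[ℝ] 𝔼) =
      LinearMap.trace ℝ 𝔼 (((A.symm : 𝔼 →L[ℝ] 𝔼) ∘L B (X₁ y) : 𝔼 →L[ℝ] 𝔼) : 𝔼 →ₗ[ℝ] 𝔼) +
      LinearMap.trace ℝ 𝔼 (fderiv ℝ X₁ y : 𝔼 →ₗ[ℝ] 𝔼) := by
    rw [← LinearMap.trace_conj' (fderiv ℝ X₂ (τ y) : 𝔼 →ₗ[ℝ] 𝔼) A.symm.toLinearEquiv, ← map_add]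
    congr 1
    ext1 v
    have := congrArg (fun T : 𝔼 →L[ℝ] 𝔼 => A.symm (T v)) hXX
    simp [hsymm v, hA] at this
    simp [LinearEquiv.conj_apply, this, add_comm]
  have hsd : (SignType.sign d : ℝ) * d = |d| := by
    rw [mul_comm]; exact_mod_cast self_mul_sign d
  simp only [Function.comp_apply, add_apply, smul_apply,
    ContinuousLinearMap.comp_apply, smul_eq_mul, fderiv_det]
  rw [htr, hry, hXy, hdy, ← hd]
  simp only [ContinuousLinearEquiv.coe_coe]
  linear_combination (r₂ (τ y) * LinearMap.trace ℝ 𝔼 (((A.symm : 𝔼 →L[ℝ] 𝔼) ∘L B (X₁ y) : 𝔼 →L[ℝ] 𝔼) : 𝔼 →ₗ[ℝ] 𝔼)) * hsd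

end euclid

section
variable {n : ℕ} {M : Type*} [TopologicalSpace M]
    [ChartedSpace (EuclideanSpace ℝ (Fin n)) M] [IsManifold (𝓡 n) ∞ M]
local notation "𝔼" => EuclideanSpace ℝ (Fin n)

theorem isManifold_of_smooth (k : ℕ) : IsManifold (𝓡 n) k M :=
  IsManifold.of_le (n := ∞) (by exact_mod_cast le_top)

/-- The smooth function `ω(X)`. -/
noncomputable def SmoothOneForm.eval (w : SmoothOneForm n M) (X : SmoothVectorField n M) :
    SmoothFun n M :=
  ⟨fun x => w x (X x), by
    have := ContMDiff.clm_bundle_apply (F₁ := 𝔼) (F₂ := ℝ)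
      (E₁ := (TangentSpace (𝓡 n) : M → Type _)) (E₂ := Bundle.Trivial M ℝ)
      w.contMDiff X.contMDiff
    intro x
    exact (Bundle.contMDiffAt_totalSpace.1 (this x)).2⟩

/-- `dω = 0`: in every chart `x₀` the pull-back `z ↦ ω_z` of the form to the chart's target
satisfies `dω(u, v) = D_u (ω_z(v)) - D_v (ω_z(u)) = 0` for all constant vectors `u`, `v`. -/
def SmoothOneForm.IsClosed (w : SmoothOneForm n M) : Prop :=
  ∀ x₀ : M, ∀ y ∈ (extChartAt (𝓡 n) x₀).target, ∀ u v : 𝔼,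
    fderiv ℝ (fun z => w ((extChartAt (𝓡 n) x₀).symm z)
      (mfderiv 𝓘(ℝ, 𝔼) (𝓡 n) (extChartAt (𝓡 n) x₀).symm z v)) y u =
    fderiv ℝ (fun z => w ((extChartAt (𝓡 n) x₀).symm z)
      (mfderiv 𝓘(ℝ, 𝔼) (𝓡 n) (extChartAt (𝓡 n) x₀).symm z u)) y v

/-- The smooth function `X(f)`. -/
noncomputable def SmoothVectorField.deriv (X : SmoothVectorField n M) (f : SmoothFun n M) :
    SmoothFun n M :=
  ⟨fun x => mvfderiv (𝓡 n) f x (X x), by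
    have h := (f.contMDiff.contMDiff_tangentMap (m := ∞) (by simp)).comp X.contMDiff
    exact (contMDiff_snd_tangentBundle_modelSpace ℝ 𝓘(ℝ, ℝ)).comp h⟩

/-- The Lie bracket `[X, Y]`. -/
noncomputable def SmoothVectorField.lie (X Y : SmoothVectorField n M) : SmoothVectorField n M :=
  ⟨fun x => mlieBracket (𝓡 n) X Y x, by
    have : IsManifold (𝓡 n) (minSmoothness ℝ 2) M := by
      rw [minSmoothness_of_isRCLikeNormedField]; exact_mod_cast isManifold_of_smooth 2
    have : IsManifold (𝓡 n) (minSmoothness ℝ 3) M := by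
      rw [minSmoothness_of_isRCLikeNormedField]; exact_mod_cast isManifold_of_smooth 3
    have : IsManifold (𝓡 n) (((⊤ : ℕ∞) : WithTop ℕ∞) + 1) M := by
      simpa using (inferInstance : IsManifold (𝓡 n) ∞ M)
    exact ContDiff.mlieBracket_vectorField (n := ⊤) X.contMDiff Y.contMDiff (by simp)⟩

/-- The vector field `X` in the chart `x₀`, with components `X^i = (X.coord x₀ y) i`. -/
noncomputable def SmoothVectorField.coord (X : SmoothVectorField n M) (x₀ : M) (y : 𝔼) : 𝔼 :=
  mfderiv (𝓡 n) 𝓘(ℝ, 𝔼) (extChartAt (𝓡 n) x₀) ((extChartAt (𝓡 n) x₀).symm y)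
    (X ((extChartAt (𝓡 n) x₀).symm y))

theorem chart_comp_symm {x₀ : M} {y : 𝔼} (hy : y ∈ (extChartAt (𝓡 n) x₀).target) :
    (mfderiv (𝓡 n) 𝓘(ℝ, 𝔼) (extChartAt (𝓡 n) x₀) ((extChartAt (𝓡 n) x₀).symm y)) ∘L
      (mfderiv 𝓘(ℝ, 𝔼) (𝓡 n) (extChartAt (𝓡 n) x₀).symm y) = ContinuousLinearMap.id ℝ _ := by
  have : IsManifold (𝓡 n) 1 M := by exact_mod_cast isManifold_of_smooth 1
  simpa using mfderiv_extChartAt_comp_mfderivWithin_extChartAt_symm hy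

theorem symm_comp_chart {x₀ : M} {y : 𝔼} (hy : y ∈ (extChartAt (𝓡 n) x₀).target) :
    (mfderiv 𝓘(ℝ, 𝔼) (𝓡 n) (extChartAt (𝓡 n) x₀).symm y) ∘L 
    (mfderiv (𝓡 n) 𝓘(ℝ, 𝔼) (extChartAt (𝓡 n) x₀) ((extChartAt (𝓡 n) x₀).symm y))
       = ContinuousLinearMap.id ℝ _ := by
  have : IsManifold (𝓡 n) 1 M := by exact_mod_cast isManifold_of_smooth 1
  simpa using mfderivWithin_extChartAt_symm_comp_mfderiv_extChartAt hy

theorem symm_coord (X : SmoothVectorField n M) {x₀ : M} {y : 𝔼} (hy : y ∈ (extChartAt (𝓡 n) x₀).target) :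
    mfderiv 𝓘(ℝ, 𝔼) (𝓡 n) (extChartAt (𝓡 n) x₀).symm y (X.coord x₀ y) =
     X ((extChartAt (𝓡 n) x₀).symm y) :=
  congrArg (fun T => T (X ((extChartAt (𝓡 n) x₀).symm y))) (symm_comp_chart hy)

theorem coord_eq_mpullbackWithin (X : SmoothVectorField n M) {x₀ : M} {y : 𝔼}
    (hy : y ∈ (extChartAt (𝓡 n) x₀).target) :
    X.coord x₀ y = mpullbackWithin 𝓘(ℝ, 𝔼) (𝓡 n) (extChartAt (𝓡 n) x₀).symm X
      (Set.range (𝓡 n)) y := by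
  rw [mpullbackWithin_apply]
  have h2 : (mfderivWithin 𝓘(ℝ, 𝔼) (𝓡 n) (extChartAt (𝓡 n) x₀).symm (Set.range (𝓡 n)) y).inverse
    = mfderiv (𝓡 n) 𝓘(ℝ, 𝔼) (extChartAt (𝓡 n) x₀) ((extChartAt (𝓡 n) x₀).symm y) := by
    rw [(𝓡 n).range_eq_univ, mfderivWithin_univ]
    exact ContinuousLinearMap.inverse_eq (symm_comp_chart hy) (chart_comp_symm hy)
  rw [h2]; rfl

theorem contMDiffOn_symm (x₀ : M) :
    ContMDiffOn 𝓘(ℝ, 𝔼) (𝓡 n) ∞ (extChartAt (𝓡 n) x₀).symm (extChartAt (𝓡 n) x₀).target :=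
  contMDiffOn_extChartAt_symm x₀

theorem contDiffOn_coord (X : SmoothVectorField n M) (x₀ : M) :
    ContDiffOn ℝ ∞ (X.coord x₀) (extChartAt (𝓡 n) x₀).target := by
  have : IsManifold (𝓡 n) 1 M := by exact_mod_cast isManifold_of_smooth 1
  rw [← contMDiffOn_iff_contDiffOn]
  have h1 : ContMDiffOn (𝓡 n) 𝓘(ℝ, 𝔼) ∞ (fun p => (trivializationAt 𝔼 (TangentSpace (𝓡 n)) x₀ ⟨p, X p⟩).2)
      (chartAt 𝔼 x₀).source := by
    have := (Bundle.Trivialization.contMDiffOn_section_iff  (IB := 𝓡 n) (n := ∞) (s := fun p => X p) (trivializationAt 𝔼 (TangentSpace (𝓡 n) : M → Type _) x₀)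
      (a := (chartAt 𝔼 x₀).source) (chartAt 𝔼 x₀).open_source (by simp)).1 X.contMDiff.contMDiffOn
    exact this
  have h2 := h1.comp (contMDiffOn_symm x₀) (fun y hy => by
    simpa using (extChartAt (𝓡 n) x₀).map_target hy)
  refine h2.congr fun y hy => ?_
  have hs : (extChartAt (𝓡 n) x₀).symm y ∈ (chartAt 𝔼 x₀).source := by
    simpa using (extChartAt (𝓡 n) x₀).map_target hy
  have := TangentBundle.continuousLinearMapAt_trivializationAt (I := 𝓡 n) hs
  refine (congrArg (fun T => T (X ((extChartAt (𝓡 n) x₀).symm y))) this).symm.trans ?_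
  have h3 := congrFun (Bundle.Trivialization.coe_linearMapAt_of_mem (R := ℝ)
    (trivializationAt 𝔼 (TangentSpace (𝓡 n) : M → Type _) x₀) (b := (extChartAt (𝓡 n) x₀).symm y)
    (by simpa using hs)) (X ((extChartAt (𝓡 n) x₀).symm y))
  exact h3

theorem contDiffOn_symm_comp (f : SmoothFun n M) (x₀ : M) :
    ContDiffOn ℝ ∞ (fun y => f ((extChartAt (𝓡 n) x₀).symm y)) (extChartAt (𝓡 n) x₀).target := by
  rw [← contMDiffOn_iff_contDiffOn]
  exact f.contMDiff.comp_contMDiffOn (contMDiffOn_symm x₀)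

theorem fderiv_symm_comp (f : SmoothFun n M) {x₀ : M} {y : 𝔼}
    (hy : y ∈ (extChartAt (𝓡 n) x₀).target) (v : 𝔼) :
    fderiv ℝ (fun y => f ((extChartAt (𝓡 n) x₀).symm y)) y v =
    mvfderiv (𝓡 n) f ((extChartAt (𝓡 n) x₀).symm y) 
      (mfderiv 𝓘(ℝ, 𝔼) (𝓡 n) (extChartAt (𝓡 n) x₀).symm y v) := by
  have h1 : MDifferentiableAt 𝓘(ℝ, 𝔼) (𝓡 n) (extChartAt (𝓡 n) x₀).symm y :=
    ((contMDiffOn_symm x₀).contMDiffAt ((isOpen_extChartAt_target x₀).mem_nhds hy)).mdifferentiableAt (by simp)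
  rw [← mfderiv_eq_fderiv]
  have := mfderiv_comp (I'' := 𝓘(ℝ, ℝ)) y (g := f) f.mdifferentiableAt h1
  exact congrArg (fun T => T v) this

theorem deriv_coord (X : SmoothVectorField n M) (f : SmoothFun n M) {x₀ : M} {y : 𝔼}
    (hy : y ∈ (extChartAt (𝓡 n) x₀).target) :
    X.deriv f ((extChartAt (𝓡 n) x₀).symm y) =
      fderiv ℝ (fun y => f ((extChartAt (𝓡 n) x₀).symm y)) y (X.coord x₀ y) := by
  rw [fderiv_symm_comp f hy, symm_coord X hy]; rfl

theorem SmoothVectorField.lie_deriv (X Y : SmoothVectorField n M) (f : SmoothFun n M) :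
   (X.lie Y).deriv f = X.deriv (Y.deriv f) - Y.deriv (X.deriv f) := by
  have : IsManifold (𝓡 n) 1 M := by exact_mod_cast isManifold_of_smooth 1
  ext x
  set y := extChartAt (𝓡 n) x x with hy
  have hyt : y ∈ (extChartAt (𝓡 n) x).target := mem_extChartAt_target x
  have hyn : (extChartAt (𝓡 n) x).target ∈ 𝓝 y := (isOpen_extChartAt_target x).mem_nhds hyt
  have hx : (extChartAt (𝓡 n) x).symm y = x := extChartAt_to_inv x
  set g := fun z => f ((extChartAt (𝓡 n) x).symm z) with hg
  have hgc : ContDiffAt ℝ ∞ g y := (contDiffOn_symm_comp f x).contDiffAt hyn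
  have hgc2 : ContDiffAt ℝ 2 g y := hgc.of_le ENat.LEInfty.out
  have hgd : DifferentiableAt ℝ (fderiv ℝ g) y :=
    (hgc2.fderiv_right (m := 1) (by norm_num)).differentiableAt one_ne_zero
  have key : ∀ (V : SmoothVectorField n M) (w : 𝔼), 
      fderiv ℝ (fun z => V.deriv f ((extChartAt (𝓡 n) x).symm z)) y w =
       fderiv ℝ (fderiv ℝ g) y w (V.coord x y) + fderiv ℝ g y (fderiv ℝ (V.coord x) y w) := by
    intro V w
    have hV : DifferentiableAt ℝ (V.coord x) y :=
      ((contDiffOn_coord V x).contDiffAt hyn).differentiableAt (by simp)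
    have h1 : (fun z => V.deriv f ((extChartAt (𝓡 n) x).symm z)) =ᶠ[𝓝 y]
       fun z => fderiv ℝ g z (V.coord x z) :=
      Filter.eventually_of_mem hyn fun z hz => deriv_coord V f hz
    rw [h1.fderiv_eq, (hgd.hasFDerivAt.clm_apply hV.hasFDerivAt).fderiv]
    simp [add_comm]
  have hbr : (X.lie Y).coord x y = fderiv ℝ (Y.coord x) y (X.coord x y) -
      fderiv ℝ (X.coord x) y (Y.coord x y) := by
    have hp : ∀ V : SmoothVectorField n M, V.coord x y = V x := by
      intro V
      have : ∀ p, p = x → mfderiv (𝓡 n) 𝓘(ℝ, 𝔼) (extChartAt (𝓡 n) x) p (V p) = V x := by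
        rintro p rfl
        rw [mfderiv_extChartAt_self]; rfl
      exact this _ hx
    have hl : (X.lie Y) x = lieBracket ℝ (X.coord x) (Y.coord x) y := by
      change mlieBracketWithin (𝓡 n) X Y Set.univ x = _
      rw [mlieBracketWithin_apply, mfderiv_extChartAt_self, (𝓡 n).range_eq_univ]
      have hc : ∀ V : SmoothVectorField n M, mpullbackWithin 𝓘(ℝ, 𝔼) (𝓡 n)
          (extChartAt (𝓡 n) x).symm V Set.univ =ᶠ[𝓝 y] V.coord x := fun V =>
        Filter.eventually_of_mem hyn fun z hz => by
          rw [coord_eq_mpullbackWithin V hz, (𝓡 n).range_eq_univ]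
      have hid : ∀ w : 𝔼, (ContinuousLinearMap.id ℝ (TangentSpace (𝓡 n) x)).inverse w = w := by
        intro w
        rw [ContinuousLinearMap.inverse_id]; rfl
      refine (hid _).trans ?_
      rw [Set.preimage_univ, Set.univ_inter]
      refine (congrFun lieBracketWithin_univ y).trans ?_
      exact (hc X).lieBracket_vectorField_eq (hc Y)
    rw [hp, hl]; rfl
  have e : ∀ h : SmoothFun n M, h x = h ((extChartAt (𝓡 n) x).symm y) := fun h => by rw [hx]
  rw [ContMDiffMap.coe_sub, Pi.sub_apply, e, e, e, deriv_coord _ _ hyt, deriv_coord _ _ hyt,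
    deriv_coord _ _ hyt, key, key, hbr, (hgc2.isSymmSndFDerivAt (by simp)).eq (X.coord x y) (Y.coord x y)]
  rw [map_sub]; ring

/-- A smooth nowhere vanishing `1`-density: a map on `n`-tuples of tangent vectors that is multiplied
by `|det A|` under a linear map `A`, and whose value on coordinate frames is smooth. -/
structure SmoothDensity (n : ℕ) (M : Type*) [TopologicalSpace M]
    [ChartedSpace (EuclideanSpace ℝ (Fin n)) M] where
  toFun : ∀ x : M, (Fin n → TangentSpace (𝓡 n) x) → ℝ
  map_det : ∀ (x : M) (A : TangentSpace (𝓡 n) x →ₗ[ℝ] TangentSpace (𝓡 n) x)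
    (v : Fin n → TangentSpace (𝓡 n) x),
    toFun x (fun i => A (v i)) = |LinearMap.det A| * toFun x v
  smooth : ∀ x₀ : M, ContDiffOn ℝ ∞ (fun y => toFun ((extChartAt (𝓡 n) x₀).symm y)
    (fun i => mfderiv 𝓘(ℝ, EuclideanSpace ℝ (Fin n)) (𝓡 n) (extChartAt (𝓡 n) x₀).symm y
        (EuclideanSpace.basisFun (Fin n) ℝ i))) (extChartAt (𝓡 n) x₀).target
  ne_zero : ∀ x : M, toFun x ≠ 0

namespace SmoothDensity

/-- The coefficient `r` in `η = r |dx¹ ⋯ dxⁿ|` in the chart `x₀`. -/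
noncomputable def coeff (η : SmoothDensity n M) (x₀ : M) (y : 𝔼) : ℝ :=
  η.toFun ((extChartAt (𝓡 n) x₀).symm y)
    (fun i => mfderiv 𝓘(ℝ, 𝔼) (𝓡 n) (extChartAt (𝓡 n) x₀).symm y
      (EuclideanSpace.basisFun (Fin n) ℝ i))

theorem coeff_ne_zero (η : SmoothDensity n M) {x₀ : M} {y : 𝔼}
    (hy : y ∈ (extChartAt (𝓡 n) x₀).target) : η.coeff x₀ y ≠ 0 := by
  intro h0
  apply η.ne_zero ((extChartAt (𝓡 n) x₀).symm y)
  ext v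
  let P : 𝔼 →L[ℝ] 𝔼 := mfderiv 𝓘(ℝ, 𝔼) (𝓡 n) (extChartAt (𝓡 n) x₀).symm y
  let Q : 𝔼 →L[ℝ] 𝔼 := mfderiv (𝓡 n) 𝓘(ℝ, 𝔼) (extChartAt (𝓡 n) x₀) ((extChartAt (𝓡 n) x₀).symm y)
  have hQP : ∀ w, Q (P w) = w := fun w => congrArg (fun T => T w) (chart_comp_symm hy)
  let A : 𝔼 →ₗ[ℝ] 𝔼 := ((EuclideanSpace.basisFun (Fin n) ℝ).toBasis.constr ℝ v) ∘ₗ (Q : 𝔼 →ₗ[ℝ] 𝔼)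
  have hA : ∀ i, A (P (EuclideanSpace.basisFun (Fin n) ℝ i)) = v i := by
    intro i
    have := (EuclideanSpace.basisFun (Fin n) ℝ).toBasis.constr_basis ℝ v i
    simpa [A, hQP] using! this
  have h1 := η.map_det ((extChartAt (𝓡 n) x₀).symm y) A
    (fun i => P (EuclideanSpace.basisFun (Fin n) ℝ i))
  have h2 : (fun i => A (P (EuclideanSpace.basisFun (Fin n) ℝ i))) = v := funext hA
  have h3 : η.toFun ((extChartAt (𝓡 n) x₀).symm y) v =
      |LinearMap.det A| * η.coeff x₀ y := by
    rw [← h2]; exact h1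
  rw [h3, h0, mul_zero]; rfl

theorem transition (η : SmoothDensity n M) (X : SmoothVectorField n M) {x₁ x₂ : M} {y : 𝔼}
    (hy : y ∈ (extChartAt (𝓡 n) x₁).target)
    (hy' : (extChartAt (𝓡 n) x₁).symm y ∈ (extChartAt (𝓡 n) x₂).source) :
    (∃ A : 𝔼 ≃L[ℝ] 𝔼,
      fderiv ℝ (fun z => extChartAt (𝓡 n) x₂ ((extChartAt (𝓡 n) x₁).symm z)) y = A) ∧
    η.coeff x₁ y = |LinearMap.det
      (fderiv ℝ (fun z => extChartAt (𝓡 n) x₂ ((extChartAt (𝓡 n) x₁).symm z)) y : 𝔼 →ₗ[ℝ] 𝔼)| *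
        η.coeff x₂ (extChartAt (𝓡 n) x₂ ((extChartAt (𝓡 n) x₁).symm y)) ∧
    X.coord x₂ (extChartAt (𝓡 n) x₂ ((extChartAt (𝓡 n) x₁).symm y)) =
      fderiv ℝ (fun z => extChartAt (𝓡 n) x₂ ((extChartAt (𝓡 n) x₁).symm z)) y (X.coord x₁ y) := by
  have : IsManifold (𝓡 n) 1 M := by exact_mod_cast isManifold_of_smooth 1
  set p := (extChartAt (𝓡 n) x₁).symm y with hp
  set y' := extChartAt (𝓡 n) x₂ p with hy'd
  have hyt' : y' ∈ (extChartAt (𝓡 n) x₂).target := (extChartAt (𝓡 n) x₂).map_source hy'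
  have hpp : (extChartAt (𝓡 n) x₂).symm y' = p := (extChartAt (𝓡 n) x₂).left_inv hy'
  let P₁ : 𝔼 →L[ℝ] 𝔼 := mfderiv 𝓘(ℝ, 𝔼) (𝓡 n) (extChartAt (𝓡 n) x₁).symm y
  let P₂ : 𝔼 →L[ℝ] 𝔼 := mfderiv 𝓘(ℝ, 𝔼) (𝓡 n) (extChartAt (𝓡 n) x₂).symm y'
  let Q₁ : 𝔼 →L[ℝ] 𝔼 := mfderiv (𝓡 n) 𝓘(ℝ, 𝔼) (extChartAt (𝓡 n) x₁) p
  let Q₂ : 𝔼 →L[ℝ] 𝔼 := mfderiv (𝓡 n) 𝓘(ℝ, 𝔼) (extChartAt (𝓡 n) x₂) p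
  have a1 : ∀ w, Q₁ (P₁ w) = w := fun w => congrArg (fun T => T w) (chart_comp_symm hy)
  have a2 : ∀ w, P₁ (Q₁ w) = w := fun w => congrArg (fun T => T w) (symm_comp_chart hy)
  have gen : ∀ q, q = p → ∀ w : 𝔼,
      (mfderiv (𝓡 n) 𝓘(ℝ, 𝔼) (extChartAt (𝓡 n) x₂) q : 𝔼 →L[ℝ] 𝔼) w = Q₂ w := by
    rintro q rfl w; rfl
  have a3 : ∀ w, Q₂ (P₂ w) = w := fun w =>
    (gen _ hpp _).symm.trans (congrArg (fun T => T w) (chart_comp_symm hyt'))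
  have a4 : ∀ w, P₂ (Q₂ w) = w := fun w =>
    (congrArg P₂ (gen _ hpp w).symm).trans (congrArg (fun T => T w) (symm_comp_chart hyt'))
  have hD : fderiv ℝ (fun z => extChartAt (𝓡 n) x₂ ((extChartAt (𝓡 n) x₁).symm z)) y = Q₂ ∘L P₁ := by
    have h1 : MDifferentiableAt 𝓘(ℝ, 𝔼) (𝓡 n) (extChartAt (𝓡 n) x₁).symm y :=
      ((contMDiffOn_symm x₁).contMDiffAt
        ((isOpen_extChartAt_target x₁).mem_nhds hy)).mdifferentiableAt (by simp)
    have h2 : MDifferentiableAt (𝓡 n) 𝓘(ℝ, 𝔼) (extChartAt (𝓡 n) x₂) p :=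
      mdifferentiableAt_extChartAt (by simpa using hy')
    rw [← mfderiv_eq_fderiv]
    exact mfderiv_comp (I'' := 𝓘(ℝ, 𝔼)) y h2 h1
  refine ⟨⟨ContinuousLinearEquiv.equivOfInverse (Q₂ ∘L P₁) (Q₁ ∘L P₂)
    (fun w => by simp [a4, a1]) (fun w => by simp [a2, a3]), ?_⟩, ?_, ?_⟩
  · rw [hD]; rfl
  · rw [hD]
    let B : 𝔼 →ₗ[ℝ] 𝔼 := (P₂ : 𝔼 →ₗ[ℝ] 𝔼) * ((Q₂ ∘L P₁ : 𝔼 →L[ℝ] 𝔼) : 𝔼 →ₗ[ℝ] 𝔼) * (Q₂ : 𝔼 →ₗ[ℝ] 𝔼)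
    have hB : ∀ w, B (P₂ w) = P₁ w := by
      intro w; simp [B, a3, a4]
    have hdet : LinearMap.det B = LinearMap.det ((Q₂ ∘L P₁ : 𝔼 →L[ℝ] 𝔼) : 𝔼 →ₗ[ℝ] 𝔼) := by
      have h1 : (P₂ : 𝔼 →ₗ[ℝ] 𝔼) * (Q₂ : 𝔼 →ₗ[ℝ] 𝔼) = 1 := by ext1 w; exact a4 w
      have h2 := congrArg LinearMap.det h1
      rw [map_mul, map_one] at h2
      simp only [B, map_mul]
      linear_combination (LinearMap.det ((Q₂ ∘L P₁ : 𝔼 →L[ℝ] 𝔼) : 𝔼 →ₗ[ℝ] 𝔼)) * h2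
    have h1 := η.map_det p B (fun i => P₂ (EuclideanSpace.basisFun (Fin n) ℝ i))
    replace h1 := h1.trans (congrArg (fun t : ℝ => |t| * _) hdet)
    have e1 : (fun i => B (P₂ (EuclideanSpace.basisFun (Fin n) ℝ i))) =
      fun i => P₁ (EuclideanSpace.basisFun (Fin n) ℝ i) := funext fun i => hB _
    have gen' : ∀ q, q = p → ∀ v : Fin n → 𝔼, η.toFun q v = η.toFun p v := by
      rintro q rfl v; rfl
    refine (congrArg (η.toFun p) e1.symm).trans (h1.trans ?_)
    rw [← gen' _ hpp]; rfl
  · rw [hD]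
    have h1 : (Q₂ ∘L P₁) (X.coord x₁ y) = Q₂ (X p) := congrArg Q₂ (symm_coord X hy)
    rw [h1]
    have gen' : ∀ q, q = p → (mfderiv (𝓡 n) 𝓘(ℝ, 𝔼) (extChartAt (𝓡 n) x₂) q : 𝔼 →L[ℝ] 𝔼) (X q) = Q₂ (X p) := by
      rintro q rfl; rfl
    exact gen' _ hpp

/-- The quotient `(L_X η) / η` at the point `x`, computed in the preferred chart at `x`. -/
noncomputable def divAt (η : SmoothDensity n M) (X : SmoothVectorField n M) (x : M) : ℝ :=
  lieDerivCoeff (η.coeff x) (X.coord x) (extChartAt (𝓡 n) x x) / η.coeff x (extChartAt (𝓡 n) x x)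

/-- In every chart, `L_X η = (div X) η`. -/
theorem lieDerivCoeff_eq_divAt (η : SmoothDensity n M) (X : SmoothVectorField n M) (x₀ : M) {y : 𝔼}
    (hy : y ∈ (extChartAt (𝓡 n) x₀).target) :
    lieDerivCoeff (η.coeff x₀) (X.coord x₀) y =
      η.divAt X ((extChartAt (𝓡 n) x₀).symm y) * η.coeff x₀ y := by
  set x := (extChartAt (𝓡 n) x₀).symm y with hx
  set z := extChartAt (𝓡 n) x x with hz
  have hzt : z ∈ (extChartAt (𝓡 n) x).target := mem_extChartAt_target x
  have hzx : (extChartAt (𝓡 n) x).symm z = x := extChartAt_to_inv x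
  have hxs : x ∈ (extChartAt (𝓡 n) x₀).source := (extChartAt (𝓡 n) x₀).map_target hy
  have hτz : extChartAt (𝓡 n) x₀ ((extChartAt (𝓡 n) x).symm z) = y := by
    rw [hzx, hx, (extChartAt (𝓡 n) x₀).right_inv hy]
  have hnz : (extChartAt (𝓡 n) x).target ∈ 𝓝 z := (isOpen_extChartAt_target x).mem_nhds hzt
  have hny : (extChartAt (𝓡 n) x₀).target ∈ 𝓝 y := (isOpen_extChartAt_target x₀).mem_nhds hy
  have hcs : ContMDiffAt 𝓘(ℝ, 𝔼) (𝓡 n) ∞ (extChartAt (𝓡 n) x).symm z :=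
    (contMDiffOn_symm x).contMDiffAt hnz
  have hev : ∀ᶠ w in 𝓝 z, w ∈ (extChartAt (𝓡 n) x).target ∧
      (extChartAt (𝓡 n) x).symm w ∈ (extChartAt (𝓡 n) x₀).source := by
    refine Filter.Eventually.and hnz (hcs.continuousAt.eventually_mem ?_)
    rw [hzx]
    exact (isOpen_extChartAt_source x₀).mem_nhds hxs
  have hτ : ContDiffAt ℝ ∞ (fun w => extChartAt (𝓡 n) x₀ ((extChartAt (𝓡 n) x).symm w)) z := by
    rw [← contMDiffAt_iff_contDiffAt]
    refine ContMDiffAt.comp z (I' := 𝓡 n) ?_ hcs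
    rw [hzx]
    exact contMDiffAt_extChartAt' (by simpa using hxs)
  obtain ⟨A, hA⟩ := (η.transition X hzt (by rwa [hzx])).1
  have hc := lieDerivCoeff_change (r₁ := η.coeff x) (r₂ := η.coeff x₀) (X₁ := X.coord x)
    (X₂ := X.coord x₀) (hτ.of_le ENat.LEInfty.out) A hA
    (hev.mono fun w hw => (η.transition X hw.1 hw.2).2.1)
    (hev.mono fun w hw => (η.transition X hw.1 hw.2).2.2)
    (by rw [hτz]; exact ((η.smooth x₀).contDiffAt hny).differentiableAt (by simp))
    (((contDiffOn_coord X x).contDiffAt hnz).differentiableAt (by simp))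
    (by rw [hτz]; exact ((contDiffOn_coord X x₀).contDiffAt hny).differentiableAt (by simp))
  have hr := (η.transition X hzt (by rwa [hzx])).2.1
  have hne := η.coeff_ne_zero hzt
  rw [hτz] at hc hr
  rw [divAt, ← hz, hc, hr]
  rw [hr] at hne
  have h1 := left_ne_zero_of_mul hne
  have h2 := right_ne_zero_of_mul hne
  field_simp

theorem contDiffOn_lieDerivCoeff (η : SmoothDensity n M) (X : SmoothVectorField n M) (x₀ : M) :
    ContDiffOn ℝ ∞ (lieDerivCoeff (η.coeff x₀) (X.coord x₀)) (extChartAt (𝓡 n) x₀).target := by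
  refine ContDiffOn.sum fun i _ => ?_
  have h1 : ContDiffOn ℝ ∞ (fun z => η.coeff x₀ z * X.coord x₀ z i) (extChartAt (𝓡 n) x₀).target :=
    (η.smooth x₀).mul ((EuclideanSpace.proj i : 𝔼 →L[ℝ] ℝ).contDiff.comp_contDiffOn
      (contDiffOn_coord X x₀))
  exact (h1.fderiv_of_isOpen (isOpen_extChartAt_target x₀) (by simp)).clm_apply contDiffOn_const

/-- The divergence of `X` with respect to `η`: the smooth function with `L_X η = (div X) η`. -/
noncomputable def divergence (η : SmoothDensity n M) (X : SmoothVectorField n M) : SmoothFun n M :=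
  ⟨η.divAt X, by
    intro x₀
    have h1 : ContMDiffOn (𝓡 n) 𝓘(ℝ, ℝ) ∞ (fun x =>
        (fun y => lieDerivCoeff (η.coeff x₀) (X.coord x₀) y / η.coeff x₀ y) (extChartAt (𝓡 n) x₀ x))
        (extChartAt (𝓡 n) x₀).source := by
      have h2 : ContDiffOn ℝ ∞ (fun y => lieDerivCoeff (η.coeff x₀) (X.coord x₀) y / η.coeff x₀ y)
          (extChartAt (𝓡 n) x₀).target :=
        (η.contDiffOn_lieDerivCoeff X x₀).div (η.smooth x₀) fun y hy => η.coeff_ne_zero hy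
      refine h2.contMDiffOn.comp (t := (extChartAt (𝓡 n) x₀).target) ?_
        (fun x hx => (extChartAt (𝓡 n) x₀).map_source hx)
      simpa using contMDiffOn_extChartAt (I := 𝓡 n) (n := ∞) (x := x₀)
    refine (h1.congr fun x hx => ?_).contMDiffAt
      ((isOpen_extChartAt_source x₀).mem_nhds (mem_extChartAt_source x₀))
    have hy := (extChartAt (𝓡 n) x₀).map_source hx
    have := η.lieDerivCoeff_eq_divAt X x₀ hy
    rw [(extChartAt (𝓡 n) x₀).left_inv hx] at this
    beta_reduce
    rw [this, mul_div_cancel_right₀ _ (η.coeff_ne_zero hy)]⟩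
end SmoothDensity

/-! ### The Lie algebra of differential operators of order at most one -/

theorem SmoothVectorField.deriv_apply (X : SmoothVectorField n M) (f : SmoothFun n M) (x : M) :
    X.deriv f x = mvfderiv (𝓡 n) f x (X x) := rfl

theorem SmoothVectorField.deriv_mul (X : SmoothVectorField n M) (f g : SmoothFun n M) :
    X.deriv (f * g) = X.deriv f * g + f * X.deriv g := by
  ext x
  simp only [ContMDiffMap.coe_add, ContMDiffMap.coe_mul, Pi.add_apply, Pi.mul_apply,
    SmoothVectorField.deriv_apply]
  rw [mvfderiv_mul f.mdifferentiableAt g.mdifferentiableAt]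
  simp
  ring

/-- The Lie derivative `f ↦ X(f)` as a linear operator on `C^∞(M)`. -/
noncomputable def SmoothVectorField.toEnd (X : SmoothVectorField n M) :
    Module.End ℝ (SmoothFun n M) where
  toFun := X.deriv
  map_add' f g := by
    ext x
    simp only [ContMDiffMap.coe_add, Pi.add_apply, SmoothVectorField.deriv_apply]
    rw [mvfderiv_add f.mdifferentiableAt g.mdifferentiableAt]
    rfl
  map_smul' c f := by
    ext x
    simp only [ContMDiffMap.coe_smul, Pi.smul_apply, SmoothVectorField.deriv_apply, RingHom.id_apply]
    have h := const_smul_mfderiv (f.mdifferentiableAt (x := x)) c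
    exact congrArg (fun T => T (X x)) h

/-- The operator `X + f : g ↦ X(g) + f g`. -/
noncomputable def firstOrderOp (X : SmoothVectorField n M) (f : SmoothFun n M) :
    Module.End ℝ (SmoothFun n M) :=
  X.toEnd + LinearMap.mulLeft ℝ f

theorem firstOrderOp_apply (X : SmoothVectorField n M) (f g : SmoothFun n M) :
    firstOrderOp X f g = X.deriv g + f * g := rfl

theorem firstOrderOp_lie (X Y : SmoothVectorField n M) (f g : SmoothFun n M) :
    ⁅firstOrderOp X f, firstOrderOp Y g⁆ =
      firstOrderOp (X.lie Y) (X.deriv g - Y.deriv f) := by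
  ext1 h
  have ha : ∀ (Z : SmoothVectorField n M) (a b : SmoothFun n M),
    Z.deriv (a + b) = Z.deriv a + Z.deriv b := fun Z => Z.toEnd.map_add
  rw [Ring.lie_def, LinearMap.sub_apply, Module.End.mul_apply, Module.End.mul_apply]
  simp only [firstOrderOp_apply, ha, SmoothVectorField.deriv_mul, SmoothVectorField.lie_deriv]
  ring

end

/-- The Lie algebra `D¹(M)` of differential operators of order at most one on `C^∞(M)`, under the
commutator bracket. -/
noncomputable def FirstOrderDiffOp (n : ℕ) (M : Type*) [TopologicalSpace M]
    [ChartedSpace (EuclideanSpace ℝ (Fin n)) M] [IsManifold (𝓡 n) ∞ M] :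
    LieSubalgebra ℝ (Module.End ℝ (SmoothFun n M)) where
  carrier := {T | ∃ (X : SmoothVectorField n M) (f : SmoothFun n M), T = firstOrderOp X f}
  zero_mem' := ⟨0, 0, by
    ext f x
    simp [firstOrderOp_apply, SmoothVectorField.deriv_apply]⟩
  add_mem' := by
    rintro _ _ ⟨X, f, rfl⟩ ⟨Y, g, rfl⟩
    refine ⟨X + Y, f + g, ?_⟩
    ext h x
    simp [firstOrderOp_apply, SmoothVectorField.deriv_apply]
    ring
  smul_mem' := by
    rintro c _ ⟨X, f, rfl⟩
    refine ⟨c • X, c • f, ?_⟩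
    ext h x
    simp [firstOrderOp_apply, SmoothVectorField.deriv_apply]
  lie_mem' := by
    rintro _ _ ⟨_, _, rfl⟩ ⟨_, _, rfl⟩
    exact ⟨_, _, firstOrderOp_lie _ _ _ _⟩

/-- The element `X + f` of `D¹(M)`. -/
noncomputable def FirstOrderDiffOp.mk {n : ℕ} {M : Type*} [TopologicalSpace M]
    [ChartedSpace (EuclideanSpace ℝ (Fin n)) M] [IsManifold (𝓡 n) ∞ M]
    (X : SmoothVectorField n M) (f : SmoothFun n M) : FirstOrderDiffOp n M :=
  ⟨firstOrderOp X f, X, f, rfl⟩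

/-!
Write `A = C^∞(M)`. Vector fields are the derivations of `A` (`vectorFieldEquiv`, from Hadamard's
lemma), so `D¹(M)` is the semidirect product `Der(A) ⋉ A`, and the description of its derivations
is to a large extent pure algebra. No locality of the given derivation is assumed or proved; what
replaces it is that the squares `(X h)²`, with `X ∈ Der(A)` and `h ∈ A`, generate the unit ideal
of `A` (`NoCommonZeros`). An identity that is known after multiplication by these squares therefore
holds. For `C^∞(M)` this follows from the existence of two functions without a common critical
point, i.e. of a map `M → ℝ²` whose differential vanishes nowhere; a generic map has this property
in positive dimension, by Baire's theorem (`exists_map_plane_fderiv_ne_zero`).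

A derivation `C` of `Der(A) ⋉ A` has four components.

* `δ : A → Der(A)` is symmetric, `δ f g = δ g f`, and commutes with the action of `Der(A)`. Applying
  equivariance to `f δ(f)` shows `(δ f f)² = 0`, so `δ = 0` as `A` is reduced
  (`equivariant_symmetric_eq_zero`).
* `φ : A → A` has a derivation as commutator with every derivation. Such an operator is a derivation
  `Y` plus a constant `κ` (`exists_eq_derivation_add_const`); connectedness of `M` makes `κ` a real
  number.
* The component `Der(A) → Der(A)` is determined by `φ`: it is `X ↦ [Y, X]`.
* `γ : Der(A) → A` is a 1-cocycle, `γ [X, Y] = X γ(Y) - Y γ(X)`. Comparing `[f X, g X]` with the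
  cocycle identity shows that `γ` is a differential operator of order one in the sense that
  `f ↦ γ(f X) - f γ(X)` is a derivation `σ(X)`. It also shows that `σ(X)` is parallel to `X`, whence
  `σ(X) = l X`, and the cocycle identity forces `X l = 0` for all `X`: so `l` is a real number
  (`cocycle_smul_eq`).

The divergence is a cocycle with symbol `l = 1`, because `div (f X) = f div X + X f`. Hence
`γ - l div` is `C^∞(M)`-linear, that is, given by a one-form, and the cocycle identity says that this
form is closed (`SmoothOneForm.isClosed_iff`). Conversely the formula defines a derivation, since
`div` and closed forms are cocycles. Uniqueness is read off from the same components.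
-/

/-! ### Cocycles and equivariant operators for the derivations of an algebra -/

section algebra
variable {A : Type*} [CommRing A] [Algebra ℝ A]

/-- The derivations of `A` have no common zero: the squares `(X h)²` generate the unit ideal.
Squares are what the polarization arguments below produce. -/
def NoCommonZeros (A : Type*) [CommRing A] [Algebra ℝ A] : Prop :=
  Ideal.span {a : A | ∃ (X : Derivation ℝ A A) (h : A), a = X h ^ 2} = ⊤

theorem NoCommonZeros.ideal_eq_top (hA : NoCommonZeros A) (I : Ideal A)
    (h : ∀ (X : Derivation ℝ A A) (h : A), X h ^ 2 ∈ I) : I = ⊤ := by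
  rw [eq_top_iff, ← hA]
  refine Ideal.span_le.2 ?_
  rintro _ ⟨X, k, rfl⟩
  exact h X k

theorem half_cancel {V : Type*} [AddCommGroup V] [Module ℝ V] {a b : V}
    (h : a + a = b + b) : a = b := by
  rw [← two_smul ℝ, ← two_smul ℝ b] at h
  exact smul_right_injective V (two_ne_zero (α := ℝ)) h

/-- An equivariant map `δ : A → Der A` with `δ f g` symmetric in `f` and `g` vanishes. The reason is
that the symmetric biderivation `δ f g` satisfies `(δ f f)² = 0`. -/
theorem equivariant_symmetric_eq_zero [IsReduced A] (δ : A →ₗ[ℝ] Derivation ℝ A A)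
    (hsymm : ∀ f g, δ f g = δ g f) (hlie : ∀ (X : Derivation ℝ A A) f, δ (X f) = ⁅X, δ f⁆) :
    δ = 0 := by
  have hmul : ∀ g h, δ (g * h) = g • δ h + h • δ g := by
    intro g h
    ext f
    rw [hsymm, Derivation.leibniz, hsymm f h, hsymm f g]
    rfl
  have hdiag : ∀ f, δ f f = 0 := by
    intro f
    -- compute `δ (f * δ f f)` by the product rule and by equivariance under `f • δ f`
    have h1 := hlie (f • δ f) f
    rw [Derivation.coe_smul, Pi.smul_apply, smul_eq_mul, hmul, hlie (δ f) f, lie_self] at h1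
    have h2 := congrArg (fun D : Derivation ℝ A A => D f) h1
    simp only [Derivation.commutator_apply, Derivation.coe_add, Derivation.coe_smul, Pi.add_apply,
      Pi.smul_apply, smul_eq_mul, Derivation.leibniz] at h2
    have h3 : (δ f f) ^ 2 = 0 := by
      apply half_cancel
      simp at h2
      linear_combination h2
    exact pow_eq_zero_iff (two_ne_zero) |>.1 h3
  ext f g
  have h := hdiag (f + g)
  simp only [map_add, Derivation.coe_add, Pi.add_apply, hdiag, zero_add, add_zero, hsymm g f] at h
  apply half_cancel
  simpa using h

/-- An operator on `A` whose commutator with every derivation is a derivation, and which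
kills `1`, is itself a derivation. -/
theorem leibniz_of_commutators (hA : NoCommonZeros A) (φ : A →ₗ[ℝ] A) (h1 : φ 1 = 0)
    (D : Derivation ℝ A A → Derivation ℝ A A) (hD : ∀ X f, φ (X f) = D X f + X (φ f)) (f g : A) :
    φ (f * g) = f * φ g + g * φ f := by
  -- the defect of the Leibniz rule, for fixed `f`
  set B : A → A := fun g => φ (f * g) - f * φ g - g * φ f with hB
  have hBadd : ∀ a b, B (a + b) = B a + B b := by
    intro a b; simp only [hB, mul_add, map_add]; ring
  -- `B ∘ X` is a derivation, being built from the commutators of `φ` with `f • X` and `X`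
  have hder : ∀ (X : Derivation ℝ A A) a b, B (X (a * b)) = a * B (X b) + b * B (X a) := by
    intro X a b
    have e : ∀ c, B (X c) = D (f • X) c - f * D X c - φ f * X c := by
      intro c
      have := hD (f • X) c
      simp only [Derivation.coe_smul, Pi.smul_apply, smul_eq_mul] at this
      simp only [hB, this, hD]
      ring
    rw [e (a * b), e a, e b]
    simp only [Derivation.leibniz, smul_eq_mul]
    ring
  have hpol : ∀ (X : Derivation ℝ A A) k a b,
      B (k * (a * X b)) + B (k * (b * X a)) = a * B (k * X b) + b * B (k * X a) := by
    intro X k a b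
    have := hder (k • X) a b
    simp only [Derivation.coe_smul, Pi.smul_apply, smul_eq_mul, Derivation.leibniz] at this
    rw [← this, ← hBadd]
    congr 1
    ring
  have hsq : ∀ (X : Derivation ℝ A A) k a, B (k * (a * X a)) = a * B (k * X a) := fun X k a =>
    half_cancel (hpol X k a a)
  -- the elements `a` such that `B` is `A`-linear on the ideal generated by `a`
  let I : Ideal A :=
    { carrier := {a | ∀ g k, B (g * (k * a)) = g * B (k * a)}
      zero_mem' := fun g k => by simp [hB]
      add_mem' := fun {a b} ha hb g k => by
        simp only [mul_add, hBadd, ha g k, hb g k]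
      smul_mem' := fun c a ha g k => by
        rw [smul_eq_mul, ← mul_assoc k, ha] }
  have hI : I = ⊤ := by
    refine hA.ideal_eq_top I fun X h g k => ?_
    have e1 := hpol X (k * X h) g h
    have e2 := hsq X (k * X g) h
    rw [show k * X g * (h * X h) = k * X h * (h * X g) by ring,
      show k * X g * X h = k * X h * X g by ring] at e2
    rw [show g * (k * X h ^ 2) = k * X h * (g * X h) by ring,
      show k * X h ^ 2 = k * X h * X h by ring]
    linear_combination e1 - e2
  have h1I : (1 : A) ∈ I := hI ▸ Submodule.mem_top
  have h2 := h1I g 1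
  -- `B g = g * B 1`, and `B 1 = 0` because `φ 1 = 0`
  simp only [mul_one, hB, h1] at h2
  linear_combination h2

/-- An operator on `A` whose commutators with derivations are derivations is itself a derivation
plus a constant. -/
theorem exists_eq_derivation_add_const (hA : NoCommonZeros A)
    (hconst : ∀ a : A, (∀ X : Derivation ℝ A A, X a = 0) → ∃ c : ℝ, a = algebraMap ℝ A c)
    (φ : A →ₗ[ℝ] A) (D : Derivation ℝ A A → Derivation ℝ A A)
    (hD : ∀ X f, φ (X f) = D X f + X (φ f)) :
    ∃ (Y : Derivation ℝ A A) (κ : ℝ), ∀ f, φ f = Y f + κ • f := by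
  obtain ⟨κ, hκ⟩ := hconst (φ 1) fun X => by
    have := hD X 1
    simpa using this.symm
  have h := leibniz_of_commutators hA (φ - κ • LinearMap.id)
    (by simp [hκ, Algebra.algebraMap_eq_smul_one]) D (fun X f => by simp [hD]; abel)
  refine ⟨Derivation.mk' (φ - κ • LinearMap.id) h, κ, fun f => ?_⟩
  simp

section cocycle

variable (γ : Derivation ℝ A A →ₗ[ℝ] A)
  (hγ : ∀ X Y : Derivation ℝ A A, γ ⁅X, Y⁆ = X (γ Y) - Y (γ X))
include hγ

/-- The cocycle identity for the fields `f X` and `g X`. -/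
theorem cocycle_smul_self (X : Derivation ℝ A A) (f g : A) :
    γ ((f * X g - g * X f) • X) = f * X (γ (g • X)) - g * X (γ (f • X)) := by
  have h : ⁅f • X, g • X⁆ = (f * X g - g * X f) • X := by
    ext a
    simp only [Derivation.commutator_apply, Derivation.coe_smul, Pi.smul_apply, smul_eq_mul,
      Derivation.leibniz]
    ring
  rw [← h, hγ]
  rfl

/-- The identity for `γ` evaluated on `[f X, g X] = (f X(g) - g X(f)) X`, where `γ` behaves as if it
were linear over `f` and `g` separately, with a further factor `k`. It is first obtained for squares
`k²`, by replacing `X` with `k X`, and then polarized. -/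
theorem cocycle_exchange (X : Derivation ℝ A A) (k f g : A) :
    γ ((k * f * X g - k * g * X f) • X) - f * γ ((k * X g) • X) + g * γ ((k * X f) • X) = 0 := by
  have hone : ∀ (X : Derivation ℝ A A) f, γ (X f • X) = X (γ (f • X)) - f * X (γ X) := by
    intro X f
    have := cocycle_smul_self γ hγ X f 1
    simp only [Derivation.map_one_eq_zero, mul_zero, one_mul, zero_sub, neg_smul, map_neg,
      one_smul] at this
    linear_combination -this
  have hk : ∀ (X : Derivation ℝ A A) f g,
      γ ((f * X g - g * X f) • X) = f * γ (X g • X) - g * γ (X f • X) := by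
    intro X f g
    rw [cocycle_smul_self γ hγ, hone, hone]; ring
  have hsq : ∀ k, γ ((k ^ 2 * f * X g - k ^ 2 * g * X f) • X) - f * γ ((k ^ 2 * X g) • X)
      + g * γ ((k ^ 2 * X f) • X) = 0 := by
    intro k
    have := hk (k • X) f g
    simp only [Derivation.coe_smul, Pi.smul_apply, smul_eq_mul, smul_smul] at this
    rw [show (f * (k * X g) - g * (k * X f)) * k = k ^ 2 * f * X g - k ^ 2 * g * X f by ring,
      show k * X g * k = k ^ 2 * X g by ring, show k * X f * k = k ^ 2 * X f by ring] at this
    linear_combination this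
  have hlin : ∀ a b, γ (((a + b) * f * X g - (a + b) * g * X f) • X) - f * γ (((a + b) * X g) • X)
      + g * γ (((a + b) * X f) • X) =
      (γ ((a * f * X g - a * g * X f) • X) - f * γ ((a * X g) • X) + g * γ ((a * X f) • X)) +
      (γ ((b * f * X g - b * g * X f) • X) - f * γ ((b * X g) • X) + g * γ ((b * X f) • X)) := by
    intro a b
    rw [show (a + b) * f * X g - (a + b) * g * X f =
      (a * f * X g - a * g * X f) + (b * f * X g - b * g * X f) by ring, add_mul, add_mul,
      add_smul, add_smul, add_smul, map_add, map_add, map_add]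
    ring
  apply half_cancel
  have h1 := hsq (k + 1)
  rw [show (k + 1) ^ 2 = k ^ 2 + ((k + k) + 1 ^ 2) by ring, hlin, hlin, hlin, hsq, hsq] at h1
  linear_combination h1

/-- On multiples of `X(f) X`, the second difference of `g ↦ γ (g ·)` vanishes. -/
theorem cocycle_second_order (X : Derivation ℝ A A) (k f g : A) :
    γ ((g ^ 2 * k * X f) • X) - 2 * g * γ ((g * k * X f) • X) + g ^ 2 * γ ((k * X f) • X) = 0 := by
  have h1 := cocycle_exchange γ hγ X k f (g * g)
  have h2 := cocycle_exchange γ hγ X (k * g) f g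
  simp only [Derivation.leibniz, smul_eq_mul] at h1
  rw [show k * f * (g * X g + g * X g) - k * (g * g) * X f =
    (k * g * f * X g - k * g * g * X f) + (k * g * f * X g - k * g * g * X f) + g ^ 2 * k * X f
    by ring,
    show k * (g * X g + g * X g) = k * g * X g + k * g * X g by ring, add_smul, add_smul, add_smul,
    map_add, map_add, map_add] at h1
  rw [show k * g * X f = g * k * X f by ring] at h2
  linear_combination h1 - 2 * h2

/-- A `1`-cocycle of `Der A` with values in `A` is a differential operator of order at most one:
for fixed `X`, the operator `f ↦ γ (f X) - f γ X` is a derivation. -/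
theorem cocycle_leibniz (hA : NoCommonZeros A) (X : Derivation ℝ A A) (f g : A) :
    γ ((f * g) • X) = f * γ (g • X) + g * γ (f • X) - f * g * γ X := by
  -- the fields on whose multiples `γ` has no second-order part
  let N : Submodule A (Derivation ℝ A A) :=
    { carrier := {Z | ∀ g k : A,
        γ ((g ^ 2 * k) • Z) - 2 * g * γ ((g * k) • Z) + g ^ 2 * γ (k • Z) = 0}
      zero_mem' := fun g k => by simp
      add_mem' := fun {a b} ha hb g k => by
        simp only [smul_add, map_add]
        linear_combination ha g k + hb g k
      smul_mem' := fun c a ha g k => by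
        simp only [smul_smul, mul_assoc]
        have := ha g (k * c)
        simpa only [mul_assoc] using this }
  have hN1 : ∀ (X : Derivation ℝ A A) h, X h • X ∈ N := by
    intro X h g k
    simp only [smul_smul]
    exact cocycle_second_order γ hγ X k h g
  have hN2 : ∀ (X Y : Derivation ℝ A A) h, X h • Y + Y h • X ∈ N := by
    intro X Y h
    have := N.sub_mem (N.sub_mem (hN1 (X + Y) h) (hN1 X h)) (hN1 Y h)
    convert this using 1
    simp only [Derivation.coe_add, Pi.add_apply, add_smul, smul_add]
    abel
  have hN3 : ∀ (X Y : Derivation ℝ A A) h, (X h ^ 2) • Y ∈ N := by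
    intro X Y h
    have := N.sub_mem (N.smul_mem (X h) (hN2 X Y h)) (N.smul_mem (Y h) (hN1 X h))
    convert this using 1
    simp only [smul_add, smul_smul, mul_comm (Y h), sq]
    abel
  -- `N` contains `(X h)² Y` for all `X`, `Y`, `h`
  let I : Ideal A :=
    { carrier := {a | ∀ Y, a • Y ∈ N}
      zero_mem' := fun Y => by simp
      add_mem' := fun {a b} ha hb Y => by rw [add_smul]; exact N.add_mem (ha Y) (hb Y)
      smul_mem' := fun c a ha Y => by
        rw [smul_eq_mul, mul_smul]; exact N.smul_mem c (ha Y) }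
  have hI : I = ⊤ := hA.ideal_eq_top I fun X h Y => hN3 X Y h
  have h1I : (1 : A) ∈ I := hI ▸ Submodule.mem_top
  have hX : X ∈ N := by simpa using h1I X
  have hd : ∀ g, γ ((g * g) • X) - 2 * g * γ (g • X) + g ^ 2 * γ X = 0 := by
    intro g
    simpa [sq] using hX g 1
  have h := hd (f + g)
  rw [show (f + g) * (f + g) = f * f + (f * g + f * g) + g * g by ring] at h
  simp only [add_smul, map_add] at h
  apply half_cancel
  linear_combination h - hd f - hd g

/-- The symbol of a `1`-cocycle `γ` of `Der A` with values in `A`: it sends `X` to the derivation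
`f ↦ γ (f X) - f γ(X)`. -/
noncomputable def cocycleSymbol (hA : NoCommonZeros A) :
    Derivation ℝ A A →ₗ[A] Derivation ℝ A A where
  toFun X := Derivation.mk' (γ ∘ₗ (LinearMap.toSpanSingleton A _ X).restrictScalars ℝ
      - LinearMap.mulRight ℝ (γ X)) (fun f g => by
    simp [cocycle_leibniz γ hγ hA X f g]
    ring)
  map_add' X Y := by
    ext f
    simp
    ring
  map_smul' k X := by
    ext f
    simp [smul_smul, cocycle_leibniz γ hγ hA X f k]
    ring

theorem cocycleSymbol_apply (hA : NoCommonZeros A) (X : Derivation ℝ A A) (f : A) :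
    cocycleSymbol γ hγ hA X f = γ (f • X) - f * γ X := by
  simp [cocycleSymbol]

/-- The symbol takes `X` to a derivation parallel to `X`. -/
theorem cocycleSymbol_parallel (hA : NoCommonZeros A) (X : Derivation ℝ A A) (g : A) :
    X g • cocycleSymbol γ hγ hA X = cocycleSymbol γ hγ hA X g • X := by
  ext f
  have h := cocycle_exchange γ hγ X 1 f g
  simp only [one_mul, sub_smul, map_sub] at h
  rw [cocycle_leibniz γ hγ hA, cocycle_leibniz γ hγ hA] at h
  simp only [Derivation.coe_smul, Pi.smul_apply, smul_eq_mul, cocycleSymbol_apply]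
  linear_combination h

end cocycle

/-- An `A`-linear endomorphism `s` of `Der A` such that `s X` is parallel to `X` for all `X` is
the multiplication by an element of `A`. -/
theorem derivation_endo_eq_smul_of_parallel (hA : NoCommonZeros A) [IsReduced A]
    (s : Derivation ℝ A A →ₗ[A] Derivation ℝ A A)
    (hs : ∀ X g, X g • s X = s X g • X) : ∃ l : A, ∀ X, s X = l • X := by
  have hpol : ∀ (X Y : Derivation ℝ A A) g, X g • s Y + Y g • s X = s X g • Y + s Y g • X := by
    intro X Y g
    have := hs (X + Y) g
    simp only [map_add, Derivation.coe_add, Pi.add_apply, add_smul, smul_add] at this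
    rw [hs X, hs Y] at this
    have h2 : s X g • X + s Y g • Y + (X g • s Y + Y g • s X) =
      s X g • X + s Y g • Y + (s X g • Y + s Y g • X) := by
      rw [show s X g • X + s Y g • Y + (X g • s Y + Y g • s X) =
        s X g • X + Y g • s X + (X g • s Y + s Y g • Y) by abel, this]
      abel
    exact add_left_cancel h2
  have key : ∀ (X Y : Derivation ℝ A A) g, (X g ^ 2) • s Y = (s X g * X g) • Y := by
    intro X Y g
    -- `Z` is a combination of `X` and `Y` that annihilates `g`
    set Z := X g • Y - Y g • X with hZ
    have hZg : Z g = 0 := by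
      simp [hZ, mul_comm]
    have hu : s Z g = 0 := by
      have h1 : s Z g • Z = 0 := by rw [← hs, hZg, zero_smul]
      have h2 : s Z g • s Z = 0 := by rw [← map_smul, h1, map_zero]
      have h3 := congrArg (fun D : Derivation ℝ A A => D g) h2
      simp only [Derivation.coe_smul, Pi.smul_apply, smul_eq_mul, Derivation.coe_zero,
        Pi.zero_apply] at h3
      exact (pow_eq_zero_iff two_ne_zero).1 (by rw [sq, h3])
    have h := hpol X Z g
    rw [hZg, hu, zero_smul, zero_smul, add_zero, add_zero, hZ, map_sub, map_smul, map_smul] at h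
    ext f
    have h' := congrArg (fun D : Derivation ℝ A A => D f) h
    have hx := congrArg (fun D : Derivation ℝ A A => D f) (hs X g)
    simp only [Derivation.coe_smul, Pi.smul_apply, smul_eq_mul, Derivation.coe_sub,
      Pi.sub_apply] at h' hx ⊢
    linear_combination h' + Y g * hx
  let I : Ideal A :=
    { carrier := {a | ∃ l : A, ∀ Y, a • s Y = l • Y}
      zero_mem' := ⟨0, fun Y => by simp⟩
      add_mem' := by
        rintro a b ⟨l, hl⟩ ⟨m, hm⟩
        exact ⟨l + m, fun Y => by rw [add_smul, add_smul, hl, hm]⟩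
      smul_mem' := by
        rintro c a ⟨l, hl⟩
        exact ⟨c * l, fun Y => by rw [smul_eq_mul, mul_smul, mul_smul, hl]⟩ }
  have hI : I = ⊤ := hA.ideal_eq_top I fun X h => ⟨_, fun Y => key X Y h⟩
  have h1I : (1 : A) ∈ I := hI ▸ Submodule.mem_top
  obtain ⟨l, hl⟩ := h1I
  exact ⟨l, fun X => by rw [← hl, one_smul]⟩

/-- A `1`-cocycle of `Der A` with values in `A` behaves on multiples `f X` like `l` times a divergence,
for a real number `l`. -/
theorem cocycle_smul_eq (hA : NoCommonZeros A) [IsReduced A]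
    (hconst : ∀ a : A, (∀ X : Derivation ℝ A A, X a = 0) → ∃ c : ℝ, a = algebraMap ℝ A c)
    (γ : Derivation ℝ A A →ₗ[ℝ] A)
    (hγ : ∀ X Y : Derivation ℝ A A, γ ⁅X, Y⁆ = X (γ Y) - Y (γ X)) :
    ∃ l : ℝ, ∀ (f : A) (X : Derivation ℝ A A), γ (f • X) = f * γ X + l • X f := by
  obtain ⟨l, hl⟩ := derivation_endo_eq_smul_of_parallel hA (cocycleSymbol γ hγ hA)
    (cocycleSymbol_parallel γ hγ hA)
  have hsm : ∀ (f : A) (X : Derivation ℝ A A), γ (f • X) = f * γ X + l * X f := by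
    intro f X
    have := cocycleSymbol_apply γ hγ hA X f
    rw [hl] at this
    simp only [Derivation.coe_smul, Pi.smul_apply, smul_eq_mul] at this
    linear_combination -this
  -- the cocycle identity for `X` and `f Y` forces `l` to be constant
  have hXl : ∀ (X Y : Derivation ℝ A A) f, X l * Y f = 0 := by
    intro X Y f
    have h1 : ⁅X, f • Y⁆ = X f • Y + f • ⁅X, Y⁆ := by
      ext a
      simp only [Derivation.commutator_apply, Derivation.coe_smul, Pi.smul_apply, smul_eq_mul,
        Derivation.leibniz, Derivation.coe_add, Pi.add_apply]
      ring
    have h2 := hγ X (f • Y)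
    rw [h1, map_add, hsm, hsm, hsm, hγ] at h2
    simp only [Derivation.commutator_apply, Derivation.coe_smul, Pi.smul_apply, smul_eq_mul,
        Derivation.leibniz, map_add] at h2
    linear_combination -h2
  obtain ⟨c, hc⟩ := hconst l fun X => by
    let I : Ideal A :=
      { carrier := {a | X l * a = 0}
        zero_mem' := by simp
        add_mem' := fun {a b} ha hb => by
          rw [Set.mem_ofPred_eq] at *
          rw [mul_add, ha, hb, add_zero]
        smul_mem' := fun c a ha => by
          rw [Set.mem_ofPred_eq] at *
          rw [smul_eq_mul, mul_left_comm, ha, mul_zero] }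
    have hI : I = ⊤ := hA.ideal_eq_top I fun Y h => by
      change X l * Y h ^ 2 = 0
      rw [sq, ← mul_assoc, hXl, zero_mul]
    have h1I : (1 : A) ∈ I := hI ▸ Submodule.mem_top
    have h2 : X l * 1 = 0 := h1I
    rwa [mul_one] at h2
  refine ⟨c, fun f X => ?_⟩
  rw [hsm, hc, Algebra.smul_def]

end algebra

/-! ### Hadamard's lemma -/

theorem contDiff_integral_segment {E F : Type*} [NormedAddCommGroup E] [NormedSpace ℝ E]
    [NormedAddCommGroup F] [NormedSpace ℝ F]
    {D : E → F} (hD : ContDiff ℝ ∞ D) (y : E) :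
    ContDiff ℝ ∞ fun z => ∫ t in (0:ℝ)..1, D (y + t • (z - y)) := by
  -- the integral over `[0, 1]` is a convolution with the indicator function of `(0, 1]`
  let χ : ContDiffBump (0 : ℝ) := ⟨2, 3, by norm_num, by norm_num⟩
  let G : E → ℝ → F := fun z s => χ s • D (y + (-s) • (z - y))
  have h := MeasureTheory.contDiffOn_convolution_right_with_param_comp (𝕜 := ℝ)
    (μ := MeasureTheory.volume) (ContinuousLinearMap.lsmul ℝ ℝ : ℝ →L[ℝ] F →L[ℝ] F)
    (s := Set.univ) (v := fun _ : E => (0 : ℝ)) (n := ⊤) contDiffOn_const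
    (f := Set.indicator (Set.Ioc (0:ℝ) 1) 1) (g := G) (k := Metric.closedBall 0 3)
    isOpen_univ (isCompact_closedBall 0 3) (by
      intro p s _ hs
      have : χ s = 0 := by
        apply χ.zero_of_le_dist
        simpa [χ] using (not_le.1 (fun h' => hs (by simpa using h'))).le
      simp [G, this])
    ((MeasureTheory.locallyIntegrable_const (1:ℝ)).indicator measurableSet_Ioc)
    (by
      apply ContDiff.contDiffOn
      have h1 : ContDiff ℝ ∞ (fun q : E × ℝ => χ q.2) := χ.contDiff.comp contDiff_snd
      have h2 : ContDiff ℝ ∞ (fun q : E × ℝ => D (y + (-q.2) • (q.1 - y))) := by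
        apply hD.comp
        fun_prop
      exact h1.smul h2)
  rw [contDiffOn_univ] at h
  convert h using 2 with z
  rw [MeasureTheory.convolution_def, intervalIntegral.integral_of_le zero_le_one,
    ← MeasureTheory.integral_indicator measurableSet_Ioc]
  congr 1
  ext t
  by_cases ht : t ∈ Set.Ioc (0:ℝ) 1
  · have : χ (-t) = 1 := by
      apply χ.one_of_mem_closedBall
      simp only [χ, Metric.mem_closedBall, dist_zero_right, norm_neg, Real.norm_eq_abs,
        abs_of_pos ht.1]
      linarith [ht.2]
    simp [ht, G, this]
  · simp [ht]

/-- Hadamard's lemma: `g z - g y` is a smooth covector, equal to `dg` at `y`, applied to `z - y`. -/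
theorem exists_hadamard {E : Type*} [NormedAddCommGroup E] [NormedSpace ℝ E]
    {g : E → ℝ} (hg : ContDiff ℝ ∞ g) (y : E) :
    ∃ G : E → E →L[ℝ] ℝ, ContDiff ℝ ∞ G ∧ (∀ z, g z = g y + G z (z - y)) ∧ G y = fderiv ℝ g y := by
  have hD : ContDiff ℝ ∞ (fderiv ℝ g) := hg.fderiv_right (by simp)
  have hG := contDiff_integral_segment hD y
  refine ⟨_, hG, fun z => ?_, by simp⟩
  have hc : Continuous fun t : ℝ => fderiv ℝ g (y + t • (z - y)) :=
    hD.continuous.comp (by fun_prop)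
  rw [ContinuousLinearMap.intervalIntegral_apply (hc.intervalIntegrable _ _)]
  have h : ∀ t ∈ Set.uIcc (0:ℝ) 1, HasDerivAt (fun t : ℝ => g (y + t • (z - y)))
      (fderiv ℝ g (y + t • (z - y)) (z - y)) t := by
    intro t _
    have h1 : HasDerivAt (fun t : ℝ => y + t • (z - y)) (z - y) t := by
      simpa using ((hasDerivAt_id t).smul_const (z - y)).const_add y
    exact (hg.differentiable (by simp) _).hasFDerivAt.comp_hasDerivAt t h1
  rw [intervalIntegral.integral_eq_sub_of_hasDerivAt h
    ((hc.clm_apply continuous_const).intervalIntegrable _ _)]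
  simp

/-! ### Extension of local data and coordinate frames -/

section geometry
variable {n : ℕ} {M : Type*} [TopologicalSpace M]
    [ChartedSpace (EuclideanSpace ℝ (Fin n)) M] [IsManifold (𝓡 n) ∞ M]
local notation "𝔼" => EuclideanSpace ℝ (Fin n)

theorem exists_bump [T2Space M] {U : Set M} (hU : IsOpen U) {x : M} (hx : x ∈ U) :
    ∃ ρ : SmoothFun n M, (∀ᶠ z in 𝓝 x, ρ z = 1) ∧ tsupport ρ ⊆ U := by
  obtain ⟨f, -, hf⟩ := (SmoothBumpFunction.nhds_basis_tsupport (I := 𝓡 n) x).mem_iff.1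
    (hU.mem_nhds hx)
  exact ⟨⟨f, f.contMDiff⟩, f.eventuallyEq_one, hf⟩

/-- Every germ of a smooth function extends to a global smooth function. -/
theorem exists_smoothFun_eventuallyEq [T2Space M] {U : Set M} (hU : IsOpen U) {x : M} (hx : x ∈ U)
    {g : M → ℝ} (hg : ContMDiffOn (𝓡 n) 𝓘(ℝ, ℝ) ∞ g U) :
    ∃ f : SmoothFun n M, ∀ᶠ z in 𝓝 x, f z = g z := by
  obtain ⟨ρ, h1, h2⟩ := exists_bump (n := n) hU hx
  refine ⟨⟨fun z => ρ z * g z, ?_⟩, ?_⟩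
  · refine contMDiff_of_tsupport fun z hz => ?_
    have hz' : z ∈ U := h2 (tsupport_mul_subset_left hz)
    exact ρ.contMDiff.contMDiffAt.mul (hg.contMDiffAt (hU.mem_nhds hz'))
  · filter_upwards [h1] with z hz
    change ρ z * g z = g z
    rw [hz, one_mul]

/-- Local vector fields extend, from a smaller neighbourhood that does not depend on the field. -/
theorem exists_section_eqOn [T2Space M] {U : Set M} (hU : IsOpen U) {x : M} (hx : x ∈ U) :
    ∃ W : Set M, IsOpen W ∧ x ∈ W ∧ W ⊆ U ∧ ∀ s : (z : M) → TangentSpace (𝓡 n) z,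
      ContMDiffOn (𝓡 n) ((𝓡 n).prod 𝓘(ℝ, 𝔼)) ∞
        (fun z => (⟨z, s z⟩ : Bundle.TotalSpace 𝔼 (TangentSpace (𝓡 n) : M → Type _))) U →
      ∃ X : SmoothVectorField n M, ∀ z ∈ W, X z = s z := by
  obtain ⟨ρ, h1, h2⟩ := exists_bump (n := n) hU hx
  obtain ⟨W, hW, hWo, hxW⟩ := eventually_nhds_iff.1 h1
  refine ⟨W ∩ U, hWo.inter hU, ⟨hxW, hx⟩, Set.inter_subset_right, fun s hs => ?_⟩
  refine ⟨⟨fun z => ρ z • s z, ContMDiffOn.smul_section_of_tsupport ρ.contMDiff.contMDiffOn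
    hU h2 hs⟩, fun z hz => ?_⟩
  change ρ z • s z = s z
  rw [hW z hz.1, one_smul]

/-- The coordinate field of the chart `x₀` with constant components `v`. -/
noncomputable def coordField (x₀ : M) (v : 𝔼) (z : M) : TangentSpace (𝓡 n) z :=
  mfderiv 𝓘(ℝ, 𝔼) (𝓡 n) (extChartAt (𝓡 n) x₀).symm (extChartAt (𝓡 n) x₀ z) v

theorem mfderiv_chart_coordField {x₀ z : M} (hz : z ∈ (extChartAt (𝓡 n) x₀).source) (v : 𝔼) :
    mfderiv (𝓡 n) 𝓘(ℝ, 𝔼) (extChartAt (𝓡 n) x₀) z (coordField x₀ v z) = v := by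
  have h := chart_comp_symm ((extChartAt (𝓡 n) x₀).map_source hz)
  rw [coordField]
  -- the two base points agree only propositionally, and the differential has a dependent type
  have gen : ∀ q, q = z → (mfderiv (𝓡 n) 𝓘(ℝ, 𝔼) (extChartAt (𝓡 n) x₀) q : 𝔼 →L[ℝ] 𝔼)
      (mfderiv 𝓘(ℝ, 𝔼) (𝓡 n) (extChartAt (𝓡 n) x₀).symm (extChartAt (𝓡 n) x₀ z) v : 𝔼) =
      (mfderiv (𝓡 n) 𝓘(ℝ, 𝔼) (extChartAt (𝓡 n) x₀) z : 𝔼 →L[ℝ] 𝔼)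
      (mfderiv 𝓘(ℝ, 𝔼) (𝓡 n) (extChartAt (𝓡 n) x₀).symm (extChartAt (𝓡 n) x₀ z) v : 𝔼) := by
    rintro q rfl; rfl
  exact (gen _ ((extChartAt (𝓡 n) x₀).left_inv hz)).symm.trans (congrArg (fun T => T v) h)

theorem contMDiffOn_coordField (x₀ : M) (v : 𝔼) :
    ContMDiffOn (𝓡 n) ((𝓡 n).prod 𝓘(ℝ, 𝔼)) ∞
      (fun z => (⟨z, coordField x₀ v z⟩ :
        Bundle.TotalSpace 𝔼 (TangentSpace (𝓡 n) : M → Type _))) (extChartAt (𝓡 n) x₀).source := by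
  rw [extChartAt_source]
  refine (Bundle.Trivialization.contMDiffOn_section_iff (IB := 𝓡 n) (n := ∞)
    (s := fun p => coordField x₀ v p) (trivializationAt 𝔼 (TangentSpace (𝓡 n) : M → Type _) x₀)
      (a := (chartAt 𝔼 x₀).source) (chartAt 𝔼 x₀).open_source (by simp)).2 ?_
  refine (contMDiffOn_const (c := v)).congr fun z hz => ?_
  have : IsManifold (𝓡 n) 1 M := by exact_mod_cast isManifold_of_smooth 1
  have h1 := TangentBundle.continuousLinearMapAt_trivializationAt (I := 𝓡 n) hz
  have h2 := congrFun (Bundle.Trivialization.coe_linearMapAt_of_mem (R := ℝ)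
    (trivializationAt 𝔼 (TangentSpace (𝓡 n) : M → Type _) x₀) (b := z)
    (by simpa using hz)) (coordField x₀ v z)
  refine h2.symm.trans ((congrArg (fun T => T (coordField x₀ v z)) h1).trans ?_)
  exact mfderiv_chart_coordField (by simpa using hz) v

/-- Around each point of the domain of the chart `x₀`, globally defined smooth functions `u i`
and vector fields `e v` that agree there with the coordinates and the constant fields. -/
theorem exists_coordinate_frame [T2Space M] {x₀ x : M} (hx : x ∈ (extChartAt (𝓡 n) x₀).source) :
    ∃ (U : Set M) (u : Fin n → SmoothFun n M) (e : 𝔼 → SmoothVectorField n M),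
      IsOpen U ∧ x ∈ U ∧ U ⊆ (extChartAt (𝓡 n) x₀).source ∧
      (∀ i, ∀ z ∈ U, u i z = extChartAt (𝓡 n) x₀ z i) ∧
      ∀ v, ∀ z ∈ U, e v z = coordField x₀ v z := by
  have hso := isOpen_extChartAt_source (I := 𝓡 n) x₀
  have h1 : ∀ i, ∃ f : SmoothFun n M, ∀ᶠ z in 𝓝 x, f z = extChartAt (𝓡 n) x₀ z i := by
    intro i
    refine exists_smoothFun_eventuallyEq hso hx ?_
    have h2 : ContMDiffOn (𝓡 n) 𝓘(ℝ, 𝔼) ∞ (extChartAt (𝓡 n) x₀) (extChartAt (𝓡 n) x₀).source := by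
      simpa using contMDiffOn_extChartAt (I := 𝓡 n) (n := ∞) (x := x₀)
    exact (EuclideanSpace.proj i : 𝔼 →L[ℝ] ℝ).contMDiff.comp_contMDiffOn h2
  choose u hu using h1
  obtain ⟨W₁, hW₁, hW₁o, hx₁⟩ := eventually_nhds_iff.1 (Filter.eventually_all.2 hu)
  obtain ⟨W₂, hW₂o, hx₂, hsub, hW₂⟩ := exists_section_eqOn (n := n) hso hx
  choose e he using fun v => hW₂ _ (contMDiffOn_coordField x₀ v)
  exact ⟨W₁ ∩ W₂, u, e, hW₁o.inter hW₂o, ⟨hx₁, hx₂⟩, fun z hz => hsub hz.2,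
    fun i z hz => hW₁ z hz.1 i, fun v z hz => he v z hz.2⟩

end geometry

/-! ### Vector fields are the derivations of the algebra of smooth functions -/

section vectorFields
variable {n : ℕ} {M : Type*} [TopologicalSpace M]
    [ChartedSpace (EuclideanSpace ℝ (Fin n)) M] [IsManifold (𝓡 n) ∞ M]
local notation "𝔼" => EuclideanSpace ℝ (Fin n)

theorem mvfderiv_coordField (f : SmoothFun n M) {x₀ z : M}
    (hz : z ∈ (extChartAt (𝓡 n) x₀).source) (w : 𝔼) :
    mvfderiv (𝓡 n) f z (coordField x₀ w z) =
      fderiv ℝ (fun y => f ((extChartAt (𝓡 n) x₀).symm y)) (extChartAt (𝓡 n) x₀ z) w := by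
  rw [fderiv_symm_comp f ((extChartAt (𝓡 n) x₀).map_source hz) w]
  have gen : ∀ q, q = z → (mvfderiv (𝓡 n) f q : 𝔼 →L[ℝ] ℝ) (coordField x₀ w z : 𝔼) =
      mvfderiv (𝓡 n) f z (coordField x₀ w z) := by
    rintro q rfl; rfl
  exact (gen _ ((extChartAt (𝓡 n) x₀).left_inv hz)).symm

theorem coordField_mfderiv_chart {x₀ z : M} (hz : z ∈ (extChartAt (𝓡 n) x₀).source)
    (v : TangentSpace (𝓡 n) z) :
    coordField x₀ (mfderiv (𝓡 n) 𝓘(ℝ, 𝔼) (extChartAt (𝓡 n) x₀) z v) z = v := by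
  have h := symm_comp_chart ((extChartAt (𝓡 n) x₀).map_source hz)
  have gen : ∀ q, q = z → (mfderiv 𝓘(ℝ, 𝔼) (𝓡 n) (extChartAt (𝓡 n) x₀).symm
      (extChartAt (𝓡 n) x₀ z) : 𝔼 →L[ℝ] 𝔼)
      ((mfderiv (𝓡 n) 𝓘(ℝ, 𝔼) (extChartAt (𝓡 n) x₀) q : 𝔼 →L[ℝ] 𝔼) (v : 𝔼)) =
      (coordField x₀ (mfderiv (𝓡 n) 𝓘(ℝ, 𝔼) (extChartAt (𝓡 n) x₀) z v) z : 𝔼) := by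
    rintro q rfl; rfl
  refine (gen _ ((extChartAt (𝓡 n) x₀).left_inv hz)).symm.trans ?_
  exact congrArg (fun T : 𝔼 →L[ℝ] 𝔼 => T v) h

theorem coordField_eq_sum (x₀ z : M) (w : 𝔼) :
    coordField x₀ w z = ∑ i, w i • coordField x₀ (EuclideanSpace.basisFun (Fin n) ℝ i) z := by
  have h : ∀ T : 𝔼 →L[ℝ] 𝔼, T w = ∑ i, w i • T (EuclideanSpace.basisFun (Fin n) ℝ i) := by
    intro T
    conv_lhs => rw [← (EuclideanSpace.basisFun (Fin n) ℝ).sum_repr w]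
    rw [map_sum]
    exact Finset.sum_congr rfl fun i _ => map_smul T _ _
  exact h (mfderiv 𝓘(ℝ, 𝔼) (𝓡 n) (extChartAt (𝓡 n) x₀).symm (extChartAt (𝓡 n) x₀ z))

/-- If `u` is the `i`-th coordinate near `z`, then `du` picks the `i`-th component. -/
theorem mvfderiv_coordinate {u : SmoothFun n M} {x₀ z : M} {i : Fin n}
    (hz : z ∈ (extChartAt (𝓡 n) x₀).source)
    (hu : ∀ᶠ p in 𝓝 z, u p = extChartAt (𝓡 n) x₀ p i) (w : 𝔼) :
    mvfderiv (𝓡 n) u z (coordField x₀ w z) = w i := by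
  rw [mvfderiv_coordField u hz]
  have ht := (extChartAt (𝓡 n) x₀).map_source hz
  have hc : ContinuousAt (extChartAt (𝓡 n) x₀).symm (extChartAt (𝓡 n) x₀ z) :=
    continuousAt_extChartAt_symm'' ht
  have h1 : (fun y => u ((extChartAt (𝓡 n) x₀).symm y)) =ᶠ[𝓝 (extChartAt (𝓡 n) x₀ z)]
      (EuclideanSpace.proj i : 𝔼 →L[ℝ] ℝ) := by
    have h2 : ∀ᶠ p in 𝓝 ((extChartAt (𝓡 n) x₀).symm (extChartAt (𝓡 n) x₀ z)),
        u p = extChartAt (𝓡 n) x₀ p i := by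
      rwa [(extChartAt (𝓡 n) x₀).left_inv hz]
    filter_upwards [hc.eventually h2, (isOpen_extChartAt_target x₀).mem_nhds ht] with y hy hyt
    rw [hy, (extChartAt (𝓡 n) x₀).right_inv hyt]
    rfl
  rw [h1.fderiv_eq, ContinuousLinearMap.fderiv]
  rfl

theorem exists_smoothVectorField_apply_eq [T2Space M] (z : M) (v : TangentSpace (𝓡 n) z) :
    ∃ X : SmoothVectorField n M, X z = v := by
  obtain ⟨U, u, e, hU, hz, hUs, hu, he⟩ := exists_coordinate_frame (n := n)
    (mem_extChartAt_source (I := 𝓡 n) z)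
  exact ⟨e _, (he _ z hz).trans (coordField_mfderiv_chart (hUs hz) v)⟩

/-- Smooth functions separate tangent vectors. -/
theorem tangentVector_ext [T2Space M] {z : M} {v w : TangentSpace (𝓡 n) z}
    (h : ∀ f : SmoothFun n M, mvfderiv (𝓡 n) f z v = mvfderiv (𝓡 n) f z w) : v = w := by
  obtain ⟨U, u, e, hU, hz, hUs, hu, he⟩ := exists_coordinate_frame (n := n)
    (mem_extChartAt_source (I := 𝓡 n) z)
  have hzs := hUs hz
  have hu' : ∀ i, ∀ᶠ p in 𝓝 z, u i p = extChartAt (𝓡 n) z p i := fun i =>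
    Filter.eventually_of_mem (hU.mem_nhds hz) (hu i)
  rw [← coordField_mfderiv_chart hzs v, ← coordField_mfderiv_chart hzs w]
  congr 1
  refine PiLp.ext fun i => ?_
  refine (mvfderiv_coordinate hzs (hu' i) _).symm.trans (Eq.trans ?_
    (mvfderiv_coordinate hzs (hu' i) _))
  rw [coordField_mfderiv_chart hzs v, coordField_mfderiv_chart hzs w, h]

theorem SmoothVectorField.ext_deriv [T2Space M] {X Y : SmoothVectorField n M}
    (h : ∀ f, X.deriv f = Y.deriv f) : X = Y := by
  apply ContMDiffSection.ext
  intro z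
  apply tangentVector_ext
  intro f
  exact congrArg (fun g : SmoothFun n M => g z) (h f)

/-- A vector field as a derivation of the algebra of smooth functions. -/
noncomputable def SmoothVectorField.toDerivation (X : SmoothVectorField n M) :
    Derivation ℝ (SmoothFun n M) (SmoothFun n M) :=
  Derivation.mk' X.toEnd fun f g => by
    change X.deriv (f * g) = f * X.deriv g + g * X.deriv f
    rw [X.deriv_mul]; ring

/-- Derivations of the algebra of smooth functions are local operators. -/
theorem derivation_congr [T2Space M] (D : Derivation ℝ (SmoothFun n M) (SmoothFun n M))
    {f g : SmoothFun n M} {z : M} (h : ∀ᶠ p in 𝓝 z, f p = g p) : D f z = D g z := by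
  obtain ⟨U, hU, hUo, hz⟩ := eventually_nhds_iff.1 h
  obtain ⟨ρ, h1, h2⟩ := exists_bump (n := n) hUo hz
  have h3 : ρ * (f - g) = 0 := by
    ext p
    change ρ p * (f p - g p) = 0
    by_cases hp : p ∈ U
    · rw [hU p hp, sub_self, mul_zero]
    · rw [image_eq_zero_of_notMem_tsupport (fun h' => hp (h2 h')), zero_mul]
  have h4 := congrArg (fun k : SmoothFun n M => k z) (congrArg D h3)
  simp only [Derivation.leibniz, map_sub, map_zero] at h4
  change ρ z * (D f z - D g z) + (f z - g z) * D ρ z = 0 at h4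
  rw [h1.self_of_nhds, h.self_of_nhds] at h4
  linarith

theorem smoothFun_sum_apply {ι : Type*} (s : Finset ι) (f : ι → SmoothFun n M) (z : M) :
    (∑ i ∈ s, f i) z = ∑ i ∈ s, f i z := by
  classical
  induction s using Finset.induction_on with
  | empty => simp
  | insert a s ha ih => rw [Finset.sum_insert ha, Finset.sum_insert ha, ← ih]; rfl

/-- By Hadamard's lemma, every derivation is near each point a combination of the coordinate
fields. -/
theorem derivation_apply_eq_sum [T2Space M] {x₀ : M} {U : Set M} {u : Fin n → SmoothFun n M}
    (hU : IsOpen U) (hUs : U ⊆ (extChartAt (𝓡 n) x₀).source)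
    (hu : ∀ i, ∀ z ∈ U, u i z = extChartAt (𝓡 n) x₀ z i)
    (D : Derivation ℝ (SmoothFun n M) (SmoothFun n M)) (f : SmoothFun n M) {z : M} (hz : z ∈ U) :
    D f z = ∑ i, D (u i) z *
      mvfderiv (𝓡 n) f z (coordField x₀ (EuclideanSpace.basisFun (Fin n) ℝ i) z) := by
  have hzs := hUs hz
  set y := extChartAt (𝓡 n) x₀ z with hy
  have ht := (extChartAt (𝓡 n) x₀).map_source hzs
  -- `g` is a function on all of Euclidean space that represents `f` in the chart near `y`
  obtain ⟨g, hg⟩ := exists_smoothFun_eventuallyEq (n := n) (isOpen_extChartAt_target x₀) ht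
    (contDiffOn_symm_comp f x₀).contMDiffOn
  have hgs : ContDiff ℝ ∞ g := contMDiff_iff_contDiff.1 g.contMDiff
  obtain ⟨G, hG, hGe, hGy⟩ := exists_hadamard hgs y
  have hGi : ∀ i, ∃ h : SmoothFun n M, ∀ᶠ p in 𝓝 z,
      h p = G (extChartAt (𝓡 n) x₀ p) (EuclideanSpace.basisFun (Fin n) ℝ i) := by
    intro i
    refine exists_smoothFun_eventuallyEq (isOpen_extChartAt_source (I := 𝓡 n) x₀) hzs ?_
    have h2 : ContMDiffOn (𝓡 n) 𝓘(ℝ, 𝔼) ∞ (extChartAt (𝓡 n) x₀) (extChartAt (𝓡 n) x₀).source := by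
      simpa using contMDiffOn_extChartAt (I := 𝓡 n) (n := ∞) (x := x₀)
    exact (hG.clm_apply contDiff_const).contMDiff.comp_contMDiffOn h2
  choose h hh using hGi
  have hcont : ContinuousAt (extChartAt (𝓡 n) x₀) z := continuousAt_extChartAt' hzs
  have hloc : ∀ᶠ p in 𝓝 z, f p = (algebraMap ℝ (SmoothFun n M) (g y) +
      ∑ i, (u i - algebraMap ℝ (SmoothFun n M) (y i)) * h i) p := by
    filter_upwards [hcont.eventually hg, Filter.eventually_all.2 hh, hU.mem_nhds hz]
      with p hp1 hp2 hp3
    have e1 : f p = g (extChartAt (𝓡 n) x₀ p) := by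
      rw [hp1, (extChartAt (𝓡 n) x₀).left_inv (hUs hp3)]
    rw [e1, hGe, ContMDiffMap.coe_add, Pi.add_apply, smoothFun_sum_apply]
    congr 1
    conv_lhs => rw [← (EuclideanSpace.basisFun (Fin n) ℝ).sum_repr (extChartAt (𝓡 n) x₀ p - y)]
    rw [map_sum]
    refine Finset.sum_congr rfl fun i _ => ?_
    rw [map_smul, ← hp2 i, smul_eq_mul, ContMDiffMap.coe_mul, Pi.mul_apply, ContMDiffMap.coe_sub,
      Pi.sub_apply, hu i p hp3]
    rfl
  rw [derivation_congr D hloc]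
  simp only [map_add, Derivation.map_algebraMap, zero_add, map_sum, Derivation.leibniz, map_sub,
    sub_zero, smoothFun_sum_apply]
  refine Finset.sum_congr rfl fun i _ => ?_
  change (u i z - y i) * D (h i) z + h i z * D (u i) z = _
  rw [hu i z hz, ← hy, sub_self, zero_mul, zero_add, (hh i).self_of_nhds, ← hy, hGy,
    mvfderiv_coordField f hzs, ← hy, Filter.EventuallyEq.fderiv_eq hg, mul_comm]

/-- Every derivation is a vector field: the local expressions agree because smooth functions separate
tangent vectors. -/
theorem exists_toDerivation_eq [T2Space M] (D : Derivation ℝ (SmoothFun n M) (SmoothFun n M)) :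
    ∃ Y : SmoothVectorField n M, Y.toDerivation = D := by
  choose U u e hU hxU hUs hu he using fun x : M => exists_coordinate_frame (n := n)
    (mem_extChartAt_source (I := 𝓡 n) x)
  let loc : M → (z : M) → TangentSpace (𝓡 n) z := fun x₀ z =>
    ∑ i, D (u x₀ i) z • e x₀ (EuclideanSpace.basisFun (Fin n) ℝ i) z
  have hloc : ∀ x₀, ∀ z ∈ U x₀, ∀ f : SmoothFun n M, mvfderiv (𝓡 n) f z (loc x₀ z) = D f z := by
    intro x₀ z hz f
    rw [derivation_apply_eq_sum (hU x₀) (hUs x₀) (hu x₀) D f hz]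
    simp only [loc, map_sum, map_smul, smul_eq_mul]
    exact Finset.sum_congr rfl fun i _ => by rw [he x₀ _ z hz]
  have hsm : ContMDiff (𝓡 n) ((𝓡 n).prod 𝓘(ℝ, 𝔼)) ∞
      (fun z => (⟨z, loc z z⟩ : Bundle.TotalSpace 𝔼 (TangentSpace (𝓡 n) : M → Type _))) := by
    intro x₀
    have h1 : ContMDiff (𝓡 n) ((𝓡 n).prod 𝓘(ℝ, 𝔼)) ∞
      (fun z => (⟨z, loc x₀ z⟩ : Bundle.TotalSpace 𝔼 (TangentSpace (𝓡 n) : M → Type _))) :=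
      ContMDiff.sum_section fun i _ => (D (u x₀ i)).contMDiff.smul_section (e x₀ _).contMDiff
    refine (h1 x₀).congr_of_eventuallyEq ?_
    filter_upwards [(hU x₀).mem_nhds (hxU x₀)] with z hz
    have : loc z z = loc x₀ z := tangentVector_ext fun f => by
      rw [hloc z z (hxU z), hloc x₀ z hz]
    rw [this]
  refine ⟨⟨fun z => loc z z, hsm⟩, ?_⟩
  ext f z
  exact hloc z z (hxU z) f

/-- `Vect(M)` is the module of derivations of `C^∞(M)`. -/
noncomputable def vectorFieldEquiv [T2Space M] :
    SmoothVectorField n M ≃ₗ[ℝ] Derivation ℝ (SmoothFun n M) (SmoothFun n M) :=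
  LinearEquiv.ofBijective
    { toFun := SmoothVectorField.toDerivation
      map_add' := fun X Y => by
        ext f z
        exact map_add (mvfderiv (𝓡 n) f z) (X z) (Y z)
      map_smul' := fun c X => by
        ext f z
        exact map_smul (mvfderiv (𝓡 n) f z) c (X z) }
    ⟨fun X Y h => SmoothVectorField.ext_deriv fun f => congrArg (fun D => D f) h,
      exists_toDerivation_eq⟩

theorem vectorFieldEquiv_apply [T2Space M] (X : SmoothVectorField n M) (f : SmoothFun n M) :
    vectorFieldEquiv X f = X.deriv f := rfl

theorem vectorFieldEquiv_symm_deriv [T2Space M]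
    (D : Derivation ℝ (SmoothFun n M) (SmoothFun n M)) (f : SmoothFun n M) :
    (vectorFieldEquiv.symm D).deriv f = D f := by
  rw [← vectorFieldEquiv_apply, LinearEquiv.apply_symm_apply]

theorem vectorFieldEquiv_lie [T2Space M] (X Y : SmoothVectorField n M) :
    vectorFieldEquiv (X.lie Y) = ⁅vectorFieldEquiv X, vectorFieldEquiv Y⁆ := by
  ext1 f
  rw [Derivation.commutator_apply]
  simp only [vectorFieldEquiv_apply]
  exact X.lie_deriv Y f

/-- On a connected manifold, a function killed by all derivations is constant. -/
theorem smoothFun_const_of_derivations [T2Space M] [ConnectedSpace M] (f : SmoothFun n M)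
    (h : ∀ D : Derivation ℝ (SmoothFun n M) (SmoothFun n M), D f = 0) :
    ∃ c : ℝ, f = algebraMap ℝ (SmoothFun n M) c := by
  have hd : ∀ z, ∀ v : TangentSpace (𝓡 n) z, mvfderiv (𝓡 n) f z v = 0 := by
    intro z v
    obtain ⟨X, rfl⟩ := exists_smoothVectorField_apply_eq z v
    exact congrArg (fun g : SmoothFun n M => g z) (h X.toDerivation)
  have hlc : IsLocallyConstant f := by
    rw [IsLocallyConstant.iff_eventually_eq]
    intro x
    have ht := mem_extChartAt_target (I := 𝓡 n) x
    obtain ⟨r, hr, hrt⟩ := Metric.isOpen_iff.1 (isOpen_extChartAt_target (I := 𝓡 n) x) _ ht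
    have hc : ContinuousAt (extChartAt (𝓡 n) x) x := continuousAt_extChartAt x
    filter_upwards [hc.eventually (Metric.ball_mem_nhds _ hr), extChartAt_source_mem_nhds (I := 𝓡 n) x]
      with z hz hzs
    have h1 : DifferentiableOn ℝ (fun y => f ((extChartAt (𝓡 n) x).symm y))
        (Metric.ball (extChartAt (𝓡 n) x x) r) :=
      ((contDiffOn_symm_comp f x).mono hrt).differentiableOn (by simp)
    have h2 := (convex_ball (extChartAt (𝓡 n) x x) r).is_const_of_fderivWithin_eq_zero h1
      (fun y hy => by
        rw [fderivWithin_of_isOpen Metric.isOpen_ball hy]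
        ext v
        rw [fderiv_symm_comp f (hrt hy), hd]
        rfl) hz (Metric.mem_ball_self hr)
    beta_reduce at h2
    rwa [(extChartAt (𝓡 n) x).left_inv hzs, (extChartAt (𝓡 n) x).left_inv
      (mem_extChartAt_source x)] at h2
  obtain ⟨x⟩ := (inferInstance : Nonempty M)
  refine ⟨f x, ?_⟩
  ext z
  exact hlc.apply_eq_of_preconnectedSpace z x

instance : IsReduced (SmoothFun n M) where
  eq_zero f hf := by
    obtain ⟨k, hk⟩ := hf
    ext z
    have h1 : ∀ m : ℕ, (f ^ m) z = f z ^ m := by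
      intro m
      induction m with
      | zero => simp
      | succ m ih => rw [pow_succ, pow_succ, ← ih]; rfl
    have h2 : f z ^ k = 0 := by rw [← h1, hk]; rfl
    exact pow_eq_zero_iff (fun h => by simp [h] at h2) |>.1 h2

end vectorFields

/-! ### Two functions without common critical points -/

/-- An easy case of Sard's theorem: the image of a `C¹` map into a space of larger dimension has dense
complement. -/
theorem dense_compl_image_of_contDiffOn {E F : Type*} [NormedAddCommGroup E] [NormedSpace ℝ E]
    [FiniteDimensional ℝ E] [NormedAddCommGroup F] [NormedSpace ℝ F] [FiniteDimensional ℝ F]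
    {f : E → F} {U C : Set E} (hU : IsOpen U) (hf : ContDiffOn ℝ 1 f U) (hC : C ⊆ U)
    (hd : Module.finrank ℝ E < Module.finrank ℝ F) : Dense (f '' C)ᶜ := by
  apply dense_compl_of_dimH_lt_finrank
  have h1 : dimH (f '' C) ≤ dimH C := dimH_image_le_of_locally_lipschitzOn fun x hx => by
    obtain ⟨K, t, ht, hK⟩ := (hf.contDiffAt (hU.mem_nhds (hC hx))).exists_lipschitzOnWith
    exact ⟨K, t, mem_nhdsWithin_of_mem_nhds ht, hK⟩
  calc dimH (f '' C) ≤ dimH C := h1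
    _ ≤ dimH (Set.univ : Set E) := dimH_mono (Set.subset_univ _)
    _ = Module.finrank ℝ E := Real.dimH_univ_eq_finrank E
    _ < Module.finrank ℝ F := by exact_mod_cast hd

/-- The projection of a closed set along a compact factor is closed. -/
theorem isClosed_exists_mem_eq_zero {X E F : Type*} [TopologicalSpace X] [TopologicalSpace E]
    [TopologicalSpace F] [T1Space F] [Zero F] {C : Set E} (hC : IsCompact C) {Φ : X → E → F}
    (hΦ : ContinuousOn (fun p : X × E => Φ p.1 p.2) (Set.univ ×ˢ C)) :
    IsClosed {a | ∃ y ∈ C, Φ a y = 0} := by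
  have : CompactSpace C := isCompact_iff_compactSpace.1 hC
  have hc : Continuous fun p : X × C => Φ p.1 p.2 :=
    hΦ.comp_continuous (f := fun p : X × C => (p.1, (p.2 : E))) (by fun_prop)
      fun p => ⟨trivial, p.2.2⟩
  have h := isClosedMap_fst_of_compactSpace (X := X) (Y := C) _
    (isClosed_singleton (x := (0 : F)) |>.preimage hc)
  convert h using 1
  ext a
  simp

section genericity
variable {n : ℕ} {M : Type*} [TopologicalSpace M]
    [ChartedSpace (EuclideanSpace ℝ (Fin n)) M] [IsManifold (𝓡 n) ∞ M]
local notation "𝔼" => EuclideanSpace ℝ (Fin n)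

/-- A field along which `h` increases away from its critical points; local gradients are glued by
convexity of the condition. -/
theorem exists_gradient_like [T2Space M] [SigmaCompactSpace M] (h : SmoothFun n M) :
    ∃ X : SmoothVectorField n M, ∀ z, (∃ w, mvfderiv (𝓡 n) h z w ≠ 0) → 0 < X.deriv h z := by
  have := exists_contMDiffSection_forall_mem_convex_of_local (n := ⊤) (𝓡 n) (F_fiber := 𝔼)
    (TangentSpace (𝓡 n) : M → Type _)
    (fun z => {v | (∃ w, mvfderiv (𝓡 n) h z w ≠ 0) → 0 < mvfderiv (𝓡 n) h z v})
    (fun z v hv w hw a b ha hb hab hne => by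
      have h1 := hv hne
      have h2 := hw hne
      rw [map_add, map_smul, map_smul, smul_eq_mul, smul_eq_mul]
      rcases ha.eq_or_lt with rfl | ha'
      · rw [zero_add] at hab
        rw [hab]; linarith
      · have := mul_pos ha' h1
        have := mul_nonneg hb h2.le
        linarith)
    (fun x₀ => by
      obtain ⟨U, u, e, hU, hx, hUs, hu, he⟩ := exists_coordinate_frame (n := n)
        (mem_extChartAt_source (I := 𝓡 n) x₀)
      -- the gradient for the Euclidean metric of the chart
      refine ⟨U, hU.mem_nhds hx, fun z => ∑ i,
        (e (EuclideanSpace.basisFun (Fin n) ℝ i)).deriv h z •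
          e (EuclideanSpace.basisFun (Fin n) ℝ i) z, ?_, ?_⟩
      · exact (ContMDiff.sum_section fun i _ =>
          (SmoothVectorField.deriv _ h).contMDiff.smul_section (e _).contMDiff).contMDiffOn
      · rintro z hz ⟨w, hw⟩
        simp only [map_sum, map_smul, smul_eq_mul, SmoothVectorField.deriv_apply]
        refine lt_of_le_of_ne (Finset.sum_nonneg fun i _ => mul_self_nonneg _) fun h0 => hw ?_
        have h1 := (Finset.sum_eq_zero_iff_of_nonneg fun i _ => mul_self_nonneg _).1 h0.symm
        obtain ⟨w', rfl⟩ : ∃ w' : 𝔼, w = coordField x₀ w' z :=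
          ⟨_, (coordField_mfderiv_chart (hUs hz) w).symm⟩
        rw [coordField_eq_sum, map_sum]
        refine Finset.sum_eq_zero fun i hi => ?_
        rw [map_smul, ← he _ z hz, mul_self_eq_zero.1 (h1 i hi), smul_zero])
  obtain ⟨X, hX⟩ := this
  exact ⟨X, hX⟩

/-- On a manifold of positive dimension there is a smooth map to the plane whose differential
vanishes nowhere. It is a sum `∑ i, a i (f i • φ i)`, where the `f i` are bump functions supported
in charts `φ i` and the `a i` are linear maps. Those `a` for which the differential vanishes
somewhere on the compact set `f i = 1` form a closed set without interior, because the differential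
there depends on `a i` by translation and `dim M < dim Hom(ℝⁿ, ℝ²)`; Baire's theorem yields
an admissible `a`. -/
theorem exists_map_plane_fderiv_ne_zero (hn : 1 ≤ n) [T2Space M] [SigmaCompactSpace M] :
    ∃ h : M → ℝ × ℝ, ContMDiff (𝓡 n) 𝓘(ℝ, ℝ × ℝ) ∞ h ∧ ∀ x : M, ∃ x₀ : M,
      x ∈ (extChartAt (𝓡 n) x₀).source ∧
      fderiv ℝ (fun y => h ((extChartAt (𝓡 n) x₀).symm y)) (extChartAt (𝓡 n) x₀ x) ≠ 0 := by
  obtain ⟨ι, f, -⟩ := SmoothBumpCovering.exists_isSubordinate (𝓡 n) (isClosed_univ (X := M))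
    (U := fun _ => Set.univ) fun _ _ => Filter.univ_mem
  have hcount : Countable ι := by
    have := f.locallyFinite.countable_univ fun i => (f i).nonempty_support
    exact Set.countable_univ_iff.1 this
  let φ := fun i => extChartAt (𝓡 n) (f.c i)
  let G : ι → M → 𝔼 := fun i x => f i x • φ i x
  have hφs : ∀ i, (φ i).source = (chartAt 𝔼 (f.c i)).source := fun i => extChartAt_source _ _
  have hφ : ∀ i, ContMDiffOn (𝓡 n) 𝓘(ℝ, 𝔼) ∞ (φ i) (φ i).source := fun i => by
    rw [hφs]
    exact contMDiffOn_extChartAt (I := 𝓡 n) (n := ∞) (x := f.c i)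
  have hG : ∀ i, ContMDiff (𝓡 n) 𝓘(ℝ, 𝔼) ∞ (G i) := fun i =>
    (f i).contMDiff_smul (hφs i ▸ hφ i)
  have hGlf : LocallyFinite fun i => Function.support (G i) :=
    f.locallyFinite.subset fun i x hx h0 => hx (by simp [G, h0])
  let H : (ι → 𝔼 →L[ℝ] ℝ × ℝ) → M → ℝ × ℝ := fun a x => ∑ᶠ i, a i (G i x)
  have hH : ∀ a, ContMDiff (𝓡 n) 𝓘(ℝ, ℝ × ℝ) ∞ (H a) := fun a =>
    contMDiff_finsum (fun i => (a i).contMDiff.comp (hG i)) (hGlf.subset fun i x hx h0 => hx (by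
      simp [show G i x = 0 from h0]))
  -- the bump functions that contribute on the support of `f i`
  have hfin : ∀ i, {j | (Function.support (f j) ∩ tsupport (f i)).Nonempty}.Finite := fun i =>
    f.locallyFinite.finite_nonempty_inter_compact (f i).hasCompactSupport
  let S : ι → Finset ι := fun i => (hfin i).toFinset
  have hS : ∀ i j x, f i x ≠ 0 → f j x ≠ 0 → j ∈ S i := fun i j x hi hj => by
    simp only [S, Set.Finite.mem_toFinset]
    exact ⟨x, hj, subset_closure hi⟩
  have hHS : ∀ a i x, f i x ≠ 0 → H a x = ∑ j ∈ S i, a j (G j x) := by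
    intro a i x hi
    refine finsum_eq_sum_of_support_subset _ fun j hj => ?_
    refine hS i j x hi fun h0 => hj ?_
    simp [G, h0]
  let C : ι → Set 𝔼 := fun i => φ i '' {x | f i x = 1}
  have hsrc : ∀ i x, f i x ≠ 0 → x ∈ (φ i).source := fun i x hx => by
    simpa [φ] using (f i).support_subset_source hx
  have hCt : ∀ i, C i ⊆ (φ i).target := by
    rintro i _ ⟨x, hx, rfl⟩
    exact (φ i).map_source (hsrc i x (by rw [show f i x = 1 from hx]; exact one_ne_zero))
  have hCsymm : ∀ i, ∀ y ∈ C i, f i ((φ i).symm y) = 1 := by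
    rintro i _ ⟨x, hx, rfl⟩
    have hx' : f i x = 1 := hx
    rw [(φ i).left_inv (hsrc i x (by rw [hx']; exact one_ne_zero)), hx']
  have hCc : ∀ i, IsCompact (C i) := by
    intro i
    have h1 : IsClosed {x | f i x = 1} := isClosed_eq (f i).continuous continuous_const
    have h2 : {x | f i x = 1} ⊆ tsupport (f i) := fun x hx =>
      subset_closure (by
        have hx' : f i x = 1 := hx
        simp [hx'])
    exact ((f i).hasCompactSupport.of_isClosed_subset h1 h2).image_of_continuousOn
      ((hφ i).continuousOn.mono fun x hx => hsrc i x (by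
        have hx' : f i x = 1 := hx
        simp [hx']))
  have hGc : ∀ i j, ContDiffOn ℝ ∞ (fun y => G j ((φ i).symm y)) (φ i).target := fun i j => by
    rw [← contMDiffOn_iff_contDiffOn]
    exact (hG j).comp_contMDiffOn (contMDiffOn_symm (f.c i))
  have hopen : ∀ i, IsOpen (φ i).target := fun i => isOpen_extChartAt_target (f.c i)
  have hGd : ∀ i j, ContDiffOn ℝ ∞ (fderiv ℝ fun y => G j ((φ i).symm y)) (φ i).target :=
    fun i j => (hGc i j).fderiv_of_isOpen (hopen i) (by simp)
  -- the differential of `H a` in the chart `φ i`, on the set where `f i = 1`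
  let Φ : ι → (ι → 𝔼 →L[ℝ] ℝ × ℝ) → 𝔼 → 𝔼 →L[ℝ] ℝ × ℝ := fun i a y =>
    ∑ j ∈ S i, (a j) ∘L (fderiv ℝ (fun y => G j ((φ i).symm y)) y)
  have hΦ : ∀ i a, ∀ y ∈ C i, fderiv ℝ (fun y => H a ((φ i).symm y)) y = Φ i a y := by
    intro i a y hy
    have hcs : ContinuousAt (φ i).symm y := continuousAt_extChartAt_symm'' (hCt i hy)
    have h1 : (fun y => H a ((φ i).symm y)) =ᶠ[𝓝 y]
        fun y => ∑ j ∈ S i, a j (G j ((φ i).symm y)) := by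
      have h2 : ∀ᶠ x in 𝓝 ((φ i).symm y), f i x ≠ 0 :=
        (f i).continuous.continuousAt.eventually_ne (by rw [hCsymm i y hy]; exact one_ne_zero)
      filter_upwards [hcs.eventually h2] with z hz
      exact hHS a i _ hz
    rw [h1.fderiv_eq]
    refine HasFDerivAt.fderiv ?_
    refine HasFDerivAt.fun_sum fun j _ => ?_
    exact (a j).hasFDerivAt.comp y ((((hGc i j).contDiffAt ((hopen i).mem_nhds (hCt i hy))
      ).differentiableAt (by simp)).hasFDerivAt)
  have hid : ∀ i, ∀ y ∈ C i, fderiv ℝ (fun y => G i ((φ i).symm y)) y =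
      ContinuousLinearMap.id ℝ 𝔼 := by
    intro i y hy
    have hyt := hCt i hy
    have hb : DifferentiableAt ℝ (fun y => f i ((φ i).symm y)) y := by
      have h1 : ContDiffOn ℝ ∞ (fun y => f i ((φ i).symm y)) (φ i).target := by
        rw [← contMDiffOn_iff_contDiffOn]
        exact (f i).contMDiff.comp_contMDiffOn (contMDiffOn_symm (f.c i))
      exact (h1.contDiffAt ((hopen i).mem_nhds hyt)).differentiableAt (by simp)
    have hmax : fderiv ℝ (fun y => f i ((φ i).symm y)) y = 0 := by
      apply IsLocalMax.fderiv_eq_zero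
      refine Filter.Eventually.of_forall fun z => ?_
      beta_reduce
      rw [hCsymm i y hy]
      exact (f i).le_one
    have h1 : (fun y => G i ((φ i).symm y)) =ᶠ[𝓝 y] fun y => f i ((φ i).symm y) • y := by
      filter_upwards [(hopen i).mem_nhds hyt] with z hz
      simp only [G]
      rw [(φ i).right_inv hz]
    rw [h1.fderiv_eq, show fderiv ℝ (fun y => f i ((φ i).symm y) • y) y = _ from
      (hb.hasFDerivAt.fun_smul (hasFDerivAt_id y)).fderiv, hmax, hCsymm i y hy]
    ext v
    simp
  let B : ι → Set (ι → 𝔼 →L[ℝ] ℝ × ℝ) := fun i => {a | ∃ y ∈ C i, Φ i a y = 0}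
  have hBclosed : ∀ i, IsClosed (B i) := by
    intro i
    apply isClosed_exists_mem_eq_zero (hCc i)
    refine continuousOn_finsetSum _ fun j _ => ?_
    have h1 : ContinuousOn (fun p : (ι → 𝔼 →L[ℝ] ℝ × ℝ) × 𝔼 =>
        fderiv ℝ (fun y => G j ((φ i).symm y)) p.2) (Set.univ ×ˢ C i) :=
      (hGd i j).continuousOn.comp continuousOn_snd fun p hp => hCt i hp.2
    exact ContinuousOn.clm_comp (by fun_prop) h1
  have hBdense : ∀ i, Dense (B i)ᶜ := by
    classical
    intro i a
    have hdim : Module.finrank ℝ 𝔼 < Module.finrank ℝ (𝔼 →L[ℝ] ℝ × ℝ) := by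
      have e : Module.finrank ℝ (𝔼 →L[ℝ] ℝ × ℝ) = Module.finrank ℝ (𝔼 →ₗ[ℝ] ℝ × ℝ) :=
        (LinearMap.toContinuousLinearMap (𝕜 := ℝ) (E := 𝔼) (F' := ℝ × ℝ)).finrank_eq.symm
      rw [e, Module.finrank_linearMap]
      simp
      omega
    have hdense : Dense ((fun y => -Φ i a y) '' C i)ᶜ := by
      refine dense_compl_image_of_contDiffOn (hopen i) ?_ (hCt i) hdim
      refine ContDiffOn.neg (ContDiffOn.sum fun j _ => ?_)
      exact contDiffOn_const.clm_comp ((hGd i j).of_le (by exact_mod_cast le_top))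
    -- move the `i`-th coordinate of `a` by a small vector outside the image of `-Φ i a`
    let m : (𝔼 →L[ℝ] ℝ × ℝ) → ι → 𝔼 →L[ℝ] ℝ × ℝ := fun t => Function.update a i (a i + t)
    have hm : Continuous m := continuous_const.update i (by fun_prop)
    have hm0 : m 0 = a := by simp [m]
    have hmΦ : ∀ t, ∀ y ∈ C i, Φ i (m t) y = Φ i a y + t := by
      intro t y hy
      have hiS : i ∈ S i := by
        have : f i ((φ i).symm y) ≠ 0 := by rw [hCsymm i y hy]; exact one_ne_zero
        exact hS i i _ this this
      simp only [Φ]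
      rw [← Finset.add_sum_erase _ _ hiS, ← Finset.add_sum_erase _ _ hiS, hid i y hy]
      have : ∀ j ∈ (S i).erase i, (m t j) ∘L fderiv ℝ (fun y => G j ((φ i).symm y)) y =
          (a j) ∘L fderiv ℝ (fun y => G j ((φ i).symm y)) y := fun j hj => by
        rw [show m t j = a j from Function.update_of_ne (Finset.ne_of_mem_erase hj) _ _]
      rw [Finset.sum_congr rfl this, show m t i = a i + t from Function.update_self _ _ _]
      simp only [ContinuousLinearMap.comp_id]
      abel
    have h1 : m 0 ∈ closure (m '' ((fun y => -Φ i a y) '' C i)ᶜ) :=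
      image_closure_subset_closure_image hm ⟨0, hdense 0, rfl⟩
    rw [hm0] at h1
    refine closure_mono ?_ h1
    rintro _ ⟨t, ht, rfl⟩ ⟨y, hy, h0⟩
    rw [hmΦ t y hy] at h0
    exact ht ⟨y, hy, (eq_neg_of_add_eq_zero_right h0).symm⟩
  obtain ⟨a, ha⟩ := (dense_iInter_of_isOpen (fun i => (hBclosed i).isOpen_compl) hBdense).nonempty
  refine ⟨H a, hH a, fun x => ?_⟩
  set i := f.ind x trivial
  have hx : f i x = 1 := f.apply_ind x trivial
  have hy : φ i x ∈ C i := ⟨x, hx, rfl⟩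
  refine ⟨f.c i, hsrc i x (by rw [hx]; exact one_ne_zero), ?_⟩
  change fderiv ℝ (fun y => H a ((φ i).symm y)) (φ i x) ≠ 0
  rw [hΦ i a _ hy]
  exact fun h0 => (Set.mem_iInter.1 ha i) ⟨_, hy, h0⟩

theorem exists_pair_no_common_critical_point (hn : 1 ≤ n) [T2Space M] [SigmaCompactSpace M] :
    ∃ h k : SmoothFun n M, ∀ x, (∃ w, mvfderiv (𝓡 n) h x w ≠ 0) ∨
      ∃ w, mvfderiv (𝓡 n) k x w ≠ 0 := by
  obtain ⟨H, hH, hne⟩ := exists_map_plane_fderiv_ne_zero (M := M) hn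
  let h : SmoothFun n M := ⟨fun x => (H x).1, (ContinuousLinearMap.fst ℝ ℝ ℝ).contMDiff.comp hH⟩
  let k : SmoothFun n M := ⟨fun x => (H x).2, (ContinuousLinearMap.snd ℝ ℝ ℝ).contMDiff.comp hH⟩
  refine ⟨h, k, fun x => ?_⟩
  obtain ⟨x₀, hx, hd⟩ := hne x
  by_contra! hcon
  apply hd
  have hy := (extChartAt (𝓡 n) x₀).map_source hx
  have hHd : DifferentiableAt ℝ (fun y => H ((extChartAt (𝓡 n) x₀).symm y))
      (extChartAt (𝓡 n) x₀ x) := by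
    have h1 : ContDiffOn ℝ ∞ (fun y => H ((extChartAt (𝓡 n) x₀).symm y))
        (extChartAt (𝓡 n) x₀).target := by
      rw [← contMDiffOn_iff_contDiffOn]
      exact hH.comp_contMDiffOn (contMDiffOn_symm x₀)
    exact (h1.contDiffAt ((isOpen_extChartAt_target x₀).mem_nhds hy)).differentiableAt (by simp)
  have h1 : ∀ w, fderiv ℝ (fun y => h ((extChartAt (𝓡 n) x₀).symm y)) (extChartAt (𝓡 n) x₀ x) w = 0 :=
    fun w => by rw [← mvfderiv_coordField h hx, hcon.1]
  have h2 : ∀ w, fderiv ℝ (fun y => k ((extChartAt (𝓡 n) x₀).symm y)) (extChartAt (𝓡 n) x₀ x) w = 0 :=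
    fun w => by rw [← mvfderiv_coordField k hx, hcon.2]
  ext1 w
  refine Prod.ext ((DFunLike.congr_fun (f := (ContinuousLinearMap.fst ℝ ℝ ℝ) ∘L _)
    (g := fderiv ℝ (fun y => h ((extChartAt (𝓡 n) x₀).symm y)) _) ?_ w).trans (h1 w))
    ((DFunLike.congr_fun (f := (ContinuousLinearMap.snd ℝ ℝ ℝ) ∘L _)
    (g := fderiv ℝ (fun y => k ((extChartAt (𝓡 n) x₀).symm y)) _) ?_ w).trans (h2 w))
  · exact ((ContinuousLinearMap.fst ℝ ℝ ℝ).hasFDerivAt.comp _ hHd.hasFDerivAt).fderiv.symm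
  · exact ((ContinuousLinearMap.snd ℝ ℝ ℝ).hasFDerivAt.comp _ hHd.hasFDerivAt).fderiv.symm

theorem noCommonZeros_smoothFun (hn : 1 ≤ n) [T2Space M] [SigmaCompactSpace M] :
    NoCommonZeros (SmoothFun n M) := by
  obtain ⟨h, k, hhk⟩ := exists_pair_no_common_critical_point (M := M) hn
  obtain ⟨X, hX⟩ := exists_gradient_like h
  obtain ⟨Y, hY⟩ := exists_gradient_like k
  let q : SmoothFun n M := X.deriv h ^ 2 + Y.deriv k ^ 2
  have hq : ∀ z, q z ≠ 0 := by
    intro z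
    have e : q z = X.deriv h z ^ 2 + Y.deriv k z ^ 2 := by
      simp only [q, sq]; rfl
    rw [e]
    rcases hhk z with h1 | h1
    · have := hX z h1
      positivity
    · have := hY z h1
      positivity
  let r : SmoothFun n M := ⟨fun z => (q z)⁻¹, q.contMDiff.inv₀ hq⟩
  have hr : r * q = 1 := by
    ext z
    exact inv_mul_cancel₀ (hq z)
  refine (Ideal.eq_top_iff_one _).2 ?_
  rw [← hr]
  refine Ideal.mul_mem_left _ _ (Ideal.add_mem _ ?_ ?_)
  · exact Ideal.subset_span ⟨X.toDerivation, h, rfl⟩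
  · exact Ideal.subset_span ⟨Y.toDerivation, k, rfl⟩

end genericity

/-! ### The divergence is a cocycle -/

section divergenceLie
variable {n : ℕ} {M : Type*} [TopologicalSpace M]
    [ChartedSpace (EuclideanSpace ℝ (Fin n)) M] [IsManifold (𝓡 n) ∞ M]
local notation "𝔼" => EuclideanSpace ℝ (Fin n)

theorem chart_map_of_symm_mem {x₀ : M} {y : 𝔼} (hy : y ∈ (extChartAt (𝓡 n) x₀).target) :
    (extChartAt (𝓡 n) x₀).symm y ∈ (extChartAt (𝓡 n) x₀).source :=
  (extChartAt (𝓡 n) x₀).map_target hy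

/-- The components of the Lie bracket in a chart. -/
theorem SmoothVectorField.lie_coord [T2Space M] (X Y : SmoothVectorField n M) {x₀ : M} {y : 𝔼}
    (hy : y ∈ (extChartAt (𝓡 n) x₀).target) :
    (X.lie Y).coord x₀ y = fderiv ℝ (Y.coord x₀) y (X.coord x₀ y) -
      fderiv ℝ (X.coord x₀) y (Y.coord x₀ y) := by
  obtain ⟨U, u, e, hU, hx, hUs, hu, he⟩ := exists_coordinate_frame (n := n)
    (chart_map_of_symm_mem hy)
  have hyn := (isOpen_extChartAt_target (I := 𝓡 n) x₀).mem_nhds hy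
  have hcs : ContinuousAt (extChartAt (𝓡 n) x₀).symm y := continuousAt_extChartAt_symm'' hy
  -- the components of a field are its derivatives of the coordinates
  have hcomp : ∀ (V : SmoothVectorField n M) i, ∀ᶠ z in 𝓝 y,
      V.deriv (u i) ((extChartAt (𝓡 n) x₀).symm z) = V.coord x₀ z i := by
    intro V i
    filter_upwards [hyn, hcs.eventually (hU.mem_nhds hx)] with z hz hzU
    rw [SmoothVectorField.deriv_apply, ← symm_coord V hz]
    have h := mvfderiv_coordinate (hUs hzU)
      (Filter.eventually_of_mem (hU.mem_nhds hzU) (hu i)) (V.coord x₀ z)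
    rw [coordField, (extChartAt (𝓡 n) x₀).right_inv hz] at h
    exact h
  have hd : ∀ (V W : SmoothVectorField n M) i,
      V.deriv (W.deriv (u i)) ((extChartAt (𝓡 n) x₀).symm y) =
        (fderiv ℝ (W.coord x₀) y (V.coord x₀ y)) i := by
    intro V W i
    rw [deriv_coord V _ hy, Filter.EventuallyEq.fderiv_eq (hcomp W i)]
    have h1 : HasFDerivAt (fun z => W.coord x₀ z i)
        ((EuclideanSpace.proj i : 𝔼 →L[ℝ] ℝ) ∘L fderiv ℝ (W.coord x₀) y) y :=
      (EuclideanSpace.proj i : 𝔼 →L[ℝ] ℝ).hasFDerivAt.comp y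
        (((contDiffOn_coord W x₀).contDiffAt hyn).differentiableAt (by simp)).hasFDerivAt
    rw [h1.fderiv]
    rfl
  refine PiLp.ext fun i => ?_
  rw [← (hcomp (X.lie Y) i).self_of_nhds, SmoothVectorField.lie_deriv]
  change X.deriv (Y.deriv (u i)) _ - Y.deriv (X.deriv (u i)) _ = _
  rw [hd, hd]
  rfl

/-- The trace as a continuous linear functional. -/
noncomputable def traceCLM (n : ℕ) :
    (EuclideanSpace ℝ (Fin n) →L[ℝ] EuclideanSpace ℝ (Fin n)) →L[ℝ] ℝ :=
  LinearMap.toContinuousLinearMap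
    ((LinearMap.trace ℝ (EuclideanSpace ℝ (Fin n))) ∘ₗ ContinuousLinearMap.coeLM ℝ)

theorem traceCLM_apply (T : 𝔼 →L[ℝ] 𝔼) : traceCLM n T = LinearMap.trace ℝ 𝔼 (T : 𝔼 →ₗ[ℝ] 𝔼) := rfl

theorem traceCLM_comp_comm (S T : 𝔼 →L[ℝ] 𝔼) : traceCLM n (S ∘L T) = traceCLM n (T ∘L S) :=
  LinearMap.trace_mul_comm ℝ (S : 𝔼 →ₗ[ℝ] 𝔼) (T : 𝔼 →ₗ[ℝ] 𝔼)

/-- The divergence with respect to the density with coefficient `r`, on Euclidean space. -/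
noncomputable def euclideanDiv (r : 𝔼 → ℝ) (X : 𝔼 → 𝔼) (z : 𝔼) : ℝ :=
  (r z)⁻¹ * fderiv ℝ r z (X z) + traceCLM n (fderiv ℝ X z)

theorem fderiv_euclideanDiv {r : 𝔼 → ℝ} {X : 𝔼 → 𝔼} {y : 𝔼} (hr : ContDiffAt ℝ ∞ r y)
    (hr0 : r y ≠ 0) (hX : ContDiffAt ℝ ∞ X y) (w : 𝔼) :
    fderiv ℝ (euclideanDiv r X) y w =
      (r y)⁻¹ * (fderiv ℝ (fderiv ℝ r) y w (X y) + fderiv ℝ r y (fderiv ℝ X y w)) -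
      (r y ^ 2)⁻¹ * fderiv ℝ r y w * fderiv ℝ r y (X y) +
      traceCLM n (fderiv ℝ (fderiv ℝ X) y w) := by
  have h1 : HasFDerivAt r (fderiv ℝ r y) y := (hr.differentiableAt (by simp)).hasFDerivAt
  have h2 : HasFDerivAt X (fderiv ℝ X y) y := (hX.differentiableAt (by simp)).hasFDerivAt
  have h3 : HasFDerivAt (fderiv ℝ r) (fderiv ℝ (fderiv ℝ r) y) y :=
    ((hr.fderiv_right (m := ∞) (by simp)).differentiableAt (by simp)).hasFDerivAt
  have h4 : HasFDerivAt (fderiv ℝ X) (fderiv ℝ (fderiv ℝ X) y) y :=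
    ((hX.fderiv_right (m := ∞) (by simp)).differentiableAt (by simp)).hasFDerivAt
  have h5 := (hasDerivAt_inv hr0).comp_hasFDerivAt y h1
  have h6 := (h5.mul (h3.clm_apply h2)).add ((traceCLM n).hasFDerivAt.comp y h4)
  have h7 : fderiv ℝ (euclideanDiv r X) y = _ := h6.fderiv
  rw [h7]
  simp
  ring

/-- The cocycle identity for the divergence on Euclidean space. The terms quadratic in the first
derivatives of the fields cancel because the trace of a commutator vanishes. -/
theorem euclideanDiv_lieBracket {r : 𝔼 → ℝ} {X Y : 𝔼 → 𝔼} {y : 𝔼} (hr : ContDiffAt ℝ ∞ r y)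
    (hr0 : r y ≠ 0) (hX : ContDiffAt ℝ ∞ X y) (hY : ContDiffAt ℝ ∞ Y y) :
    euclideanDiv r (fun z => fderiv ℝ Y z (X z) - fderiv ℝ X z (Y z)) y =
      fderiv ℝ (euclideanDiv r Y) y (X y) - fderiv ℝ (euclideanDiv r X) y (Y y) := by
  have hX2 : HasFDerivAt X (fderiv ℝ X y) y := (hX.differentiableAt (by simp)).hasFDerivAt
  have hY2 : HasFDerivAt Y (fderiv ℝ Y y) y := (hY.differentiableAt (by simp)).hasFDerivAt
  have hX4 : HasFDerivAt (fderiv ℝ X) (fderiv ℝ (fderiv ℝ X) y) y :=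
    ((hX.fderiv_right (m := ∞) (by simp)).differentiableAt (by simp)).hasFDerivAt
  have hY4 : HasFDerivAt (fderiv ℝ Y) (fderiv ℝ (fderiv ℝ Y) y) y :=
    ((hY.fderiv_right (m := ∞) (by simp)).differentiableAt (by simp)).hasFDerivAt
  have hsymm : ∀ {F : Type} [NormedAddCommGroup F] [NormedSpace ℝ F] {g : 𝔼 → F},
      ContDiffAt ℝ ∞ g y → ∀ v w, fderiv ℝ (fderiv ℝ g) y v w = fderiv ℝ (fderiv ℝ g) y w v :=
    fun hg v w => ((hg.of_le (m := 2) ENat.LEInfty.out).isSymmSndFDerivAt (by simp)).eq v w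
  have hflip : ∀ {V : 𝔼 → 𝔼}, ContDiffAt ℝ ∞ V y → ∀ w,
      (fderiv ℝ (fderiv ℝ V) y).flip w = fderiv ℝ (fderiv ℝ V) y w := fun hV w => by
    ext1 v
    exact hsymm hV v w
  rw [fderiv_euclideanDiv hr hr0 hX, fderiv_euclideanDiv hr hr0 hY, euclideanDiv,
    ((hY4.clm_apply hX2).fun_sub (hX4.clm_apply hY2)).fderiv, hflip hX, hflip hY, map_sub, map_sub,
    map_add, map_add, traceCLM_comp_comm, hsymm hr (X y) (Y y)]
  ring

theorem SmoothDensity.contDiffAt_coeff (η : SmoothDensity n M) {x₀ : M} {y : 𝔼}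
    (hy : y ∈ (extChartAt (𝓡 n) x₀).target) : ContDiffAt ℝ ∞ (η.coeff x₀) y :=
  (η.smooth x₀).contDiffAt ((isOpen_extChartAt_target (I := 𝓡 n) x₀).mem_nhds hy)

theorem SmoothDensity.divergence_symm_apply (η : SmoothDensity n M) (X : SmoothVectorField n M)
    {x₀ : M} {y : 𝔼} (hy : y ∈ (extChartAt (𝓡 n) x₀).target) :
    η.divergence X ((extChartAt (𝓡 n) x₀).symm y) =
      euclideanDiv (η.coeff x₀) (X.coord x₀) y := by
  have hyn := (isOpen_extChartAt_target (I := 𝓡 n) x₀).mem_nhds hy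
  have h1 := η.lieDerivCoeff_eq_divAt X x₀ hy
  have h0 := η.coeff_ne_zero hy
  rw [lieDerivCoeff_eq ((η.contDiffAt_coeff hy).differentiableAt (by simp))
    (((contDiffOn_coord X x₀).contDiffAt hyn).differentiableAt (by simp))] at h1
  change η.divAt X _ = _
  rw [euclideanDiv, traceCLM_apply]
  apply mul_right_cancel₀ h0
  rw [← h1, add_mul, mul_comm (η.coeff x₀ y)⁻¹, mul_assoc, inv_mul_cancel₀ h0]
  ring

theorem exists_chart_symm_eq (x : M) : ∃ y ∈ (extChartAt (𝓡 n) x).target,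
    (extChartAt (𝓡 n) x).symm y = x :=
  ⟨_, mem_extChartAt_target x, extChartAt_to_inv x⟩

theorem SmoothDensity.divergence_lie [T2Space M] (η : SmoothDensity n M)
    (X Y : SmoothVectorField n M) :
    η.divergence (X.lie Y) = X.deriv (η.divergence Y) - Y.deriv (η.divergence X) := by
  ext x
  obtain ⟨y, hy, hyx⟩ := exists_chart_symm_eq (n := n) x
  have hyn := (isOpen_extChartAt_target (I := 𝓡 n) x).mem_nhds hy
  have hd : ∀ V : SmoothVectorField n M,
      (fun z => η.divergence V ((extChartAt (𝓡 n) x).symm z)) =ᶠ[𝓝 y]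
        euclideanDiv (η.coeff x) (V.coord x) := fun V =>
    Filter.eventually_of_mem hyn fun z hz => η.divergence_symm_apply V hz
  have hl : (X.lie Y).coord x =ᶠ[𝓝 y] fun z => fderiv ℝ (Y.coord x) z (X.coord x z) -
      fderiv ℝ (X.coord x) z (Y.coord x z) :=
    Filter.eventually_of_mem hyn fun z hz => SmoothVectorField.lie_coord X Y hz
  have key : η.divergence (X.lie Y) ((extChartAt (𝓡 n) x).symm y) =
      X.deriv (η.divergence Y) ((extChartAt (𝓡 n) x).symm y) -
        Y.deriv (η.divergence X) ((extChartAt (𝓡 n) x).symm y) := by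
    rw [η.divergence_symm_apply _ hy, deriv_coord _ _ hy, deriv_coord _ _ hy, (hd X).fderiv_eq,
      (hd Y).fderiv_eq, ← euclideanDiv_lieBracket (η.contDiffAt_coeff hy)
      (η.coeff_ne_zero hy) ((contDiffOn_coord X x).contDiffAt hyn)
      ((contDiffOn_coord Y x).contDiffAt hyn)]
    rw [euclideanDiv, euclideanDiv, hl.fderiv_eq, hl.self_of_nhds]
  rw [hyx] at key
  exact key

theorem SmoothVectorField.coord_add (X Y : SmoothVectorField n M) (x₀ : M) (y : 𝔼) :
    (X + Y).coord x₀ y = X.coord x₀ y + Y.coord x₀ y :=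
  map_add (mfderiv (𝓡 n) 𝓘(ℝ, 𝔼) (extChartAt (𝓡 n) x₀) ((extChartAt (𝓡 n) x₀).symm y)) _ _

theorem SmoothVectorField.coord_eq_smul {X Y : SmoothVectorField n M} {f : SmoothFun n M}
    (h : ∀ z, Y z = f z • X z) (x₀ : M) (y : 𝔼) :
    Y.coord x₀ y = f ((extChartAt (𝓡 n) x₀).symm y) • X.coord x₀ y := by
  rw [SmoothVectorField.coord, h]
  exact map_smul (mfderiv (𝓡 n) 𝓘(ℝ, 𝔼) (extChartAt (𝓡 n) x₀) ((extChartAt (𝓡 n) x₀).symm y)) _ _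

theorem SmoothDensity.divergence_add (η : SmoothDensity n M) (X Y : SmoothVectorField n M) :
    η.divergence (X + Y) = η.divergence X + η.divergence Y := by
  ext x
  obtain ⟨y, hy, hyx⟩ := exists_chart_symm_eq (n := n) x
  have hyn := (isOpen_extChartAt_target (I := 𝓡 n) x).mem_nhds hy
  have hdif : ∀ V : SmoothVectorField n M, DifferentiableAt ℝ (V.coord x) y := fun V =>
    ((contDiffOn_coord V x).contDiffAt hyn).differentiableAt (by simp)
  have hc : (X + Y).coord x = X.coord x + Y.coord x :=
    funext fun z => SmoothVectorField.coord_add X Y x z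
  change _ = η.divergence X x + η.divergence Y x
  rw [← hyx, η.divergence_symm_apply _ hy, η.divergence_symm_apply _ hy,
    η.divergence_symm_apply _ hy]
  rw [euclideanDiv, euclideanDiv, euclideanDiv, hc, fderiv_add (hdif X) (hdif Y), Pi.add_apply,
    map_add, map_add]
  ring

/-- `div (f X) = f div X + X f`. -/
theorem SmoothDensity.divergence_eq_of_eq_smul (η : SmoothDensity n M) {X Y : SmoothVectorField n M}
    {f : SmoothFun n M} (h : ∀ z, Y z = f z • X z) :
    η.divergence Y = f * η.divergence X + X.deriv f := by
  ext x
  obtain ⟨y, hy, hyx⟩ := exists_chart_symm_eq (n := n) x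
  have hyn := (isOpen_extChartAt_target (I := 𝓡 n) x).mem_nhds hy
  have hX : DifferentiableAt ℝ (X.coord x) y :=
    ((contDiffOn_coord X x).contDiffAt hyn).differentiableAt (by simp)
  have hf : DifferentiableAt ℝ (fun z => f ((extChartAt (𝓡 n) x).symm z)) y :=
    ((contDiffOn_symm_comp f x).contDiffAt hyn).differentiableAt (by simp)
  have hc : Y.coord x = fun z => f ((extChartAt (𝓡 n) x).symm z) • X.coord x z :=
    funext fun z => SmoothVectorField.coord_eq_smul h x z
  have htr : ∀ (a : 𝔼 →L[ℝ] ℝ) (v : 𝔼), traceCLM n (a.smulRight v) = a v := fun a v =>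
    LinearMap.trace_smulRight (a : 𝔼 →ₗ[ℝ] ℝ) v
  have key : η.divergence Y ((extChartAt (𝓡 n) x).symm y) =
      f ((extChartAt (𝓡 n) x).symm y) * η.divergence X ((extChartAt (𝓡 n) x).symm y) +
        X.deriv f ((extChartAt (𝓡 n) x).symm y) := by
    rw [η.divergence_symm_apply _ hy, η.divergence_symm_apply _ hy, deriv_coord X f hy,
      euclideanDiv, euclideanDiv, hc, (hf.hasFDerivAt.fun_smul hX.hasFDerivAt).fderiv,
      map_add, map_smul, map_smul, htr, smul_eq_mul, smul_eq_mul]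
    ring
  rw [hyx] at key
  exact key

theorem SmoothDensity.divergence_smul (η : SmoothDensity n M) (c : ℝ) (X : SmoothVectorField n M) :
    η.divergence (c • X) = c • η.divergence X := by
  have h := η.divergence_eq_of_eq_smul (X := X) (Y := c • X)
    (f := algebraMap ℝ (SmoothFun n M) c) fun z => rfl
  have h2 : X.deriv (algebraMap ℝ (SmoothFun n M) c) = 0 := X.toDerivation.map_algebraMap c
  rw [h, h2, add_zero, Algebra.smul_def]

end divergenceLie

/-! ### One-forms -/

section oneForms
variable {n : ℕ} {M : Type*} [TopologicalSpace M]
    [ChartedSpace (EuclideanSpace ℝ (Fin n)) M] [IsManifold (𝓡 n) ∞ M]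
local notation "𝔼" => EuclideanSpace ℝ (Fin n)

theorem SmoothOneForm.eval_apply (w : SmoothOneForm n M) (X : SmoothVectorField n M) (z : M) :
    w.eval X z = w z (X z) := rfl

/-- A family of covectors is smooth if its components on coordinate fields are. -/
theorem contMDiffAt_oneForm (w : ∀ z : M, TangentSpace (𝓡 n) z →L[ℝ] Bundle.Trivial M ℝ z) {x₀ : M}
    (hw : ∀ v : 𝔼, ContMDiffAt (𝓡 n) 𝓘(ℝ, ℝ) ∞ (fun z => (w z (coordField x₀ v z) : ℝ)) x₀) :
    ContMDiffAt (𝓡 n) ((𝓡 n).prod 𝓘(ℝ, 𝔼 →L[ℝ] ℝ)) ∞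
      (fun z => (⟨z, w z⟩ : Bundle.TotalSpace (𝔼 →L[ℝ] ℝ)
        (fun x : M => TangentSpace (𝓡 n) x →L[ℝ] Bundle.Trivial M ℝ x))) x₀ := by
  rw [contMDiffAt_hom_bundle]
  refine ⟨contMDiffAt_id, ?_⟩
  have h1 : ContMDiffAt (𝓡 n) 𝓘(ℝ, 𝔼 →L[ℝ] ℝ) ∞ (fun z => ∑ i,
      (w z (coordField x₀ (EuclideanSpace.basisFun (Fin n) ℝ i) z) : ℝ) •
        (EuclideanSpace.proj i : 𝔼 →L[ℝ] ℝ)) x₀ :=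
    ContMDiffAt.sum fun i _ => (hw _).smul contMDiffAt_const
  refine h1.congr_of_eventuallyEq ?_
  filter_upwards [(chartAt 𝔼 x₀).open_source.mem_nhds (mem_chart_source 𝔼 x₀)] with z hz
  have hzs : z ∈ (extChartAt (𝓡 n) x₀).source := by simpa using hz
  have : IsManifold (𝓡 n) 1 M := by exact_mod_cast isManifold_of_smooth 1
  have hs := TangentBundle.symmL_trivializationAt (I := 𝓡 n) hz
  ext1 v
  have h2 : (mfderivWithin 𝓘(ℝ, 𝔼) (𝓡 n) (extChartAt (𝓡 n) x₀).symm (Set.range (𝓡 n))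
      (extChartAt (𝓡 n) x₀ z) : 𝔼 →L[ℝ] 𝔼) v = coordField x₀ v z := by
    rw [(𝓡 n).range_eq_univ, mfderivWithin_univ]; rfl
  have h3 : ContinuousLinearMap.inCoordinates 𝔼 (TangentSpace (𝓡 n)) ℝ (Bundle.Trivial M ℝ)
      x₀ z x₀ z (w z) v = (w z (coordField x₀ v z) : ℝ) := by
    rw [← h2]
    unfold ContinuousLinearMap.inCoordinates
    rw [hs]
    simp only [Bundle.Trivial.continuousLinearMapAt_trivialization, ContinuousLinearMap.id_comp,
      Bundle.Trivial.fiberBundle_trivializationAt']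
    rfl
  refine h3.trans ?_
  rw [coordField_eq_sum, map_sum, sum_apply]
  refine Finset.sum_congr rfl fun i _ => ?_
  rw [map_smul]
  exact mul_comm _ _

/-- A `C^∞(M)`-linear functional on vector fields is a smooth one-form. -/
theorem exists_oneForm_eval_eq [T2Space M]
    (α : Derivation ℝ (SmoothFun n M) (SmoothFun n M) →ₗ[SmoothFun n M] SmoothFun n M) :
    ∃ w : SmoothOneForm n M, ∀ X : SmoothVectorField n M, w.eval X = α X.toDerivation := by
  choose U u e hU hxU hUs hu he using fun x : M => exists_coordinate_frame (n := n)
    (mem_extChartAt_source (I := 𝓡 n) x)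
  let w : ∀ z : M, TangentSpace (𝓡 n) z →L[ℝ] Bundle.Trivial M ℝ z := fun z =>
    ∑ i, (α (e z (EuclideanSpace.basisFun (Fin n) ℝ i)).toDerivation z) •
      (mvfderiv (𝓡 n) (u z i) z : TangentSpace (𝓡 n) z →L[ℝ] ℝ)
  have hw : ∀ (X : SmoothVectorField n M) z, w z (X z) = α X.toDerivation z := by
    intro X z
    obtain ⟨ρ, h1, h2⟩ := exists_bump (n := n) (hU z) (hxU z)
    -- near `z` the field is the combination of the frame with coefficients `X (u i)`
    have h3 : ρ • X.toDerivation = ρ • ∑ i, X.deriv (u z i) •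
        (e z (EuclideanSpace.basisFun (Fin n) ℝ i)).toDerivation := by
      ext f p
      simp only [Derivation.coe_smul, Pi.smul_apply, smul_eq_mul, ContMDiffMap.coe_mul,
        Pi.mul_apply]
      by_cases hp : p ∈ U z
      · congr 1
        have h5 := map_sum (Derivation.coeFnAddMonoidHom (R := ℝ) (A := SmoothFun n M)
          (M := SmoothFun n M)) (fun i => X.deriv (u z i) •
            (e z (EuclideanSpace.basisFun (Fin n) ℝ i)).toDerivation) Finset.univ
        replace h5 := congrFun h5 f
        simp only [Derivation.coeFnAddMonoidHom_apply, Finset.sum_apply] at h5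
        rw [h5, smoothFun_sum_apply]
        rw [derivation_apply_eq_sum (hU z) (hUs z) (hu z) X.toDerivation f hp]
        exact Finset.sum_congr rfl fun i _ => by rw [← he z _ p hp]; rfl
      · rw [image_eq_zero_of_notMem_tsupport (fun h' => hp (h2 h')), zero_mul, zero_mul]
    have h4 := congrArg (fun g : SmoothFun n M => g z) (congrArg α h3)
    simp only [map_smul, map_sum, smul_eq_mul, ContMDiffMap.coe_mul, Pi.mul_apply,
      smoothFun_sum_apply, h1.self_of_nhds, one_mul] at h4
    rw [h4]
    simp only [w, sum_apply]
    exact Finset.sum_congr rfl fun i _ => mul_comm _ _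
  refine ⟨⟨w, fun x₀ => contMDiffAt_oneForm w fun v => ?_⟩, fun X => ?_⟩
  · refine ((α (e x₀ v).toDerivation).contMDiff x₀).congr_of_eventuallyEq ?_
    filter_upwards [(hU x₀).mem_nhds (hxU x₀)] with z hz
    rw [← he x₀ v z hz, hw]
  · ext z
    exact hw X z

theorem SmoothOneForm.ext_eval [T2Space M] {w w' : SmoothOneForm n M}
    (h : ∀ X, w.eval X = w'.eval X) : w = w' := by
  apply ContMDiffSection.ext
  intro z
  ext1 v
  obtain ⟨X, rfl⟩ := exists_smoothVectorField_apply_eq z v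
  exact congrArg (fun g : SmoothFun n M => g z) (h X)

theorem SmoothOneForm.eval_add (w : SmoothOneForm n M) (X Y : SmoothVectorField n M) :
    w.eval (X + Y) = w.eval X + w.eval Y := by
  ext z
  exact map_add (w z) (X z) (Y z)

theorem SmoothOneForm.eval_smul (w : SmoothOneForm n M) (c : ℝ) (X : SmoothVectorField n M) :
    w.eval (c • X) = c • w.eval X := by
  ext z
  exact map_smul (w z) c (X z)

theorem SmoothOneForm.eval_eq_of_eq_smul (w : SmoothOneForm n M) {X Y : SmoothVectorField n M}
    {f : SmoothFun n M} (h : ∀ z, Y z = f z • X z) : w.eval Y = f * w.eval X := by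
  ext z
  rw [SmoothOneForm.eval_apply, h]
  exact map_smul (w z) (f z) (X z)

/-- The representative of a one-form in the chart `x₀`: its pullback by the inverse of the chart, as
a function on Euclidean space with values in the dual space. -/
noncomputable def SmoothOneForm.rep (w : SmoothOneForm n M) (x₀ : M) (y : 𝔼) : 𝔼 →L[ℝ] ℝ :=
  (w ((extChartAt (𝓡 n) x₀).symm y) : 𝔼 →L[ℝ] ℝ) ∘L
    (mfderiv 𝓘(ℝ, 𝔼) (𝓡 n) (extChartAt (𝓡 n) x₀).symm y : 𝔼 →L[ℝ] 𝔼)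

theorem SmoothOneForm.eval_symm_apply (w : SmoothOneForm n M) (X : SmoothVectorField n M) {x₀ : M}
    {y : 𝔼} (hy : y ∈ (extChartAt (𝓡 n) x₀).target) :
    w.eval X ((extChartAt (𝓡 n) x₀).symm y) = w.rep x₀ y (X.coord x₀ y) := by
  rw [SmoothOneForm.eval_apply, ← symm_coord X hy]
  rfl

/-- Near each point of a chart there are fields with prescribed constant components. -/
theorem exists_coord_eventually_eq [T2Space M] {x₀ : M} {y : 𝔼}
    (hy : y ∈ (extChartAt (𝓡 n) x₀).target) (v : 𝔼) :
    ∃ X : SmoothVectorField n M, ∀ᶠ z in 𝓝 y, X.coord x₀ z = v := by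
  obtain ⟨U, u, e, hU, hx, hUs, hu, he⟩ := exists_coordinate_frame (n := n)
    (chart_map_of_symm_mem hy)
  have hcs : ContinuousAt (extChartAt (𝓡 n) x₀).symm y := continuousAt_extChartAt_symm'' hy
  refine ⟨e v, ?_⟩
  filter_upwards [(isOpen_extChartAt_target (I := 𝓡 n) x₀).mem_nhds hy,
    hcs.eventually (hU.mem_nhds hx)] with z hz hzU
  rw [SmoothVectorField.coord, he v _ hzU]
  exact mfderiv_chart_coordField (hUs hzU) v

theorem SmoothOneForm.contDiffAt_rep [T2Space M] (w : SmoothOneForm n M) {x₀ : M} {y : 𝔼}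
    (hy : y ∈ (extChartAt (𝓡 n) x₀).target) : ContDiffAt ℝ ∞ (w.rep x₀) y := by
  have hyn := (isOpen_extChartAt_target (I := 𝓡 n) x₀).mem_nhds hy
  have h : ContDiffOn ℝ ∞ (w.rep x₀) (extChartAt (𝓡 n) x₀).target := by
    rw [contDiffOn_clm_apply]
    intro v z hz
    obtain ⟨X, hX⟩ := exists_coord_eventually_eq hz v
    have hzn := (isOpen_extChartAt_target (I := 𝓡 n) x₀).mem_nhds hz
    refine (ContDiffAt.congr_of_eventuallyEq
      ((contDiffOn_symm_comp (w.eval X) x₀).contDiffAt hzn) ?_).contDiffWithinAt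
    filter_upwards [hX, hzn] with p hp hpt
    rw [w.eval_symm_apply X hpt, hp]
  exact h.contDiffAt hyn

/-- The invariant formula for the exterior derivative of a one-form, in a chart. -/
theorem SmoothOneForm.exteriorDeriv_eq [T2Space M] (w : SmoothOneForm n M)
    (X Y : SmoothVectorField n M) {x₀ : M} {y : 𝔼} (hy : y ∈ (extChartAt (𝓡 n) x₀).target) :
    (X.deriv (w.eval Y) - Y.deriv (w.eval X) - w.eval (X.lie Y))
      ((extChartAt (𝓡 n) x₀).symm y) =
    fderiv ℝ (w.rep x₀) y (X.coord x₀ y) (Y.coord x₀ y) -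
      fderiv ℝ (w.rep x₀) y (Y.coord x₀ y) (X.coord x₀ y) := by
  have hyn := (isOpen_extChartAt_target (I := 𝓡 n) x₀).mem_nhds hy
  have hw : HasFDerivAt (w.rep x₀) (fderiv ℝ (w.rep x₀) y) y :=
    ((w.contDiffAt_rep hy).differentiableAt (by simp)).hasFDerivAt
  have hV : ∀ V : SmoothVectorField n M, HasFDerivAt (V.coord x₀) (fderiv ℝ (V.coord x₀) y) y :=
    fun V => (((contDiffOn_coord V x₀).contDiffAt hyn).differentiableAt (by simp)).hasFDerivAt
  have hd : ∀ V W : SmoothVectorField n M, W.deriv (w.eval V) ((extChartAt (𝓡 n) x₀).symm y) =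
      w.rep x₀ y (fderiv ℝ (V.coord x₀) y (W.coord x₀ y)) +
        fderiv ℝ (w.rep x₀) y (W.coord x₀ y) (V.coord x₀ y) := by
    intro V W
    have h1 : (fun z => w.eval V ((extChartAt (𝓡 n) x₀).symm z)) =ᶠ[𝓝 y]
        fun z => w.rep x₀ z (V.coord x₀ z) :=
      Filter.eventually_of_mem hyn fun z hz => w.eval_symm_apply V hz
    rw [deriv_coord _ _ hy, h1.fderiv_eq, (hw.clm_apply (hV V)).fderiv]
    rfl
  rw [ContMDiffMap.coe_sub, Pi.sub_apply, ContMDiffMap.coe_sub, Pi.sub_apply, hd, hd,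
    w.eval_symm_apply _ hy, SmoothVectorField.lie_coord X Y hy, map_sub]
  ring

/-- A one-form is closed if and only if it is a cocycle on the vector fields. -/
theorem SmoothOneForm.isClosed_iff [T2Space M] (w : SmoothOneForm n M) :
    w.IsClosed ↔ ∀ X Y : SmoothVectorField n M,
      w.eval (X.lie Y) = X.deriv (w.eval Y) - Y.deriv (w.eval X) := by
  have hrep : ∀ (x₀ : M) (v : 𝔼), ∀ y ∈ (extChartAt (𝓡 n) x₀).target, ∀ u : 𝔼,
      fderiv ℝ (fun z => w ((extChartAt (𝓡 n) x₀).symm z)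
        (mfderiv 𝓘(ℝ, 𝔼) (𝓡 n) (extChartAt (𝓡 n) x₀).symm z v)) y u =
      fderiv ℝ (w.rep x₀) y u v := by
    intro x₀ v y hy u
    have hw : HasFDerivAt (w.rep x₀) (fderiv ℝ (w.rep x₀) y) y :=
      ((w.contDiffAt_rep hy).differentiableAt (by simp)).hasFDerivAt
    have h1 : fderiv ℝ (fun z => w.rep x₀ z v) y = _ :=
      (hw.clm_apply (hasFDerivAt_const v y)).fderiv
    refine (DFunLike.congr_fun h1 u).trans ?_
    simp
  constructor
  · intro h X Y
    ext x
    obtain ⟨y, hy, hyx⟩ := exists_chart_symm_eq (n := n) x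
    have h1 := w.exteriorDeriv_eq X Y hy
    rw [← hrep x _ y hy, ← hrep x _ y hy, h x y hy, sub_self, hyx] at h1
    exact (sub_eq_zero.1 h1).symm
  · intro h x₀ y hy u v
    obtain ⟨X, hX⟩ := exists_coord_eventually_eq hy u
    obtain ⟨Y, hY⟩ := exists_coord_eventually_eq hy v
    have h1 := w.exteriorDeriv_eq X Y hy
    rw [h X Y, sub_self, hX.self_of_nhds, hY.self_of_nhds] at h1
    rw [hrep x₀ _ y hy, hrep x₀ _ y hy]
    exact sub_eq_zero.1 h1.symm

end oneForms

/-! ### Derivations of the semidirect product of derivations and functions -/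

section semidirect
variable {A : Type*} [CommRing A] [Algebra ℝ A]
  {L : Type*} [LieRing L] [LieAlgebra ℝ L] (e : (Derivation ℝ A A × A) ≃ₗ[ℝ] L)

/-- In a Lie algebra `L` identified with `Der(A) ⋉ A`, a cocycle `γ : Der(A) → A` defines the
derivation `(X, f) ↦ (0, κ f + γ(X))`. -/
noncomputable def outerDerivation
    (he : ∀ X f Y g, ⁅e (X, f), e (Y, g)⁆ = e (⁅X, Y⁆, X g - Y f)) (κ : ℝ)
    (γ : Derivation ℝ A A →ₗ[ℝ] A) (hγ : ∀ X Y, γ ⁅X, Y⁆ = X (γ Y) - Y (γ X)) :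
    LieDerivation ℝ L L where
  toLinearMap := e.toLinearMap ∘ₗ LinearMap.inr ℝ _ _ ∘ₗ
    (κ • LinearMap.snd ℝ _ _ + γ ∘ₗ LinearMap.fst ℝ _ _) ∘ₗ e.symm.toLinearMap
  leibniz' S T := by
    obtain ⟨⟨X, f⟩, rfl⟩ := e.surjective S
    obtain ⟨⟨Y, g⟩, rfl⟩ := e.surjective T
    simp only [LinearMap.comp_apply, LinearEquiv.coe_coe, he, LinearEquiv.symm_apply_apply,
      LinearMap.inr_apply, LinearMap.add_apply, LinearMap.smul_apply, LinearMap.fst_apply,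
      LinearMap.snd_apply, lie_zero, Derivation.coe_zero, Pi.zero_apply, sub_zero, hγ]
    rw [← map_sub, Prod.mk_sub_mk, sub_self]
    congr 2
    simp only [map_add, Derivation.map_smul, smul_sub]
    abel

theorem outerDerivation_apply
    (he : ∀ X f Y g, ⁅e (X, f), e (Y, g)⁆ = e (⁅X, Y⁆, X g - Y f)) (κ : ℝ)
    (γ : Derivation ℝ A A →ₗ[ℝ] A) (hγ : ∀ X Y, γ ⁅X, Y⁆ = X (γ Y) - Y (γ X))
    (X : Derivation ℝ A A) (f : A) :
    outerDerivation e he κ γ hγ (e (X, f)) = e (0, κ • f + γ X) := by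
  change e (0, κ • (e.symm (e (X, f))).2 + γ (e.symm (e (X, f))).1) = _
  rw [LinearEquiv.symm_apply_apply]

/-- A derivation of the semidirect product `Der(A) ⋉ A` is, up to an inner derivation and a
multiple of the projection to `A`, a first-order cocycle on `Der(A)` with values in `A`. -/
theorem exists_eq_of_lieDerivation [IsReduced A] (hA : NoCommonZeros A)
    (hconst : ∀ a : A, (∀ X : Derivation ℝ A A, X a = 0) → ∃ c : ℝ, a = algebraMap ℝ A c)
    (he : ∀ X f Y g, ⁅e (X, f), e (Y, g)⁆ = e (⁅X, Y⁆, X g - Y f)) (D : LieDerivation ℝ L L) :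
    ∃ (Z : Derivation ℝ A A) (κ l : ℝ) (γ : Derivation ℝ A A →ₗ[ℝ] A),
      (∀ X f, D (e (X, f)) = ⁅e (Z, 0), e (X, f)⁆ + e (0, κ • f + γ X)) ∧
      (∀ X Y, γ ⁅X, Y⁆ = X (γ Y) - Y (γ X)) ∧ ∀ f X, γ (f • X) = f * γ X + l • X f := by
  let T : (Derivation ℝ A A × A) →ₗ[ℝ] Derivation ℝ A A × A :=
    e.symm.toLinearMap ∘ₗ D.toLinearMap ∘ₗ e.toLinearMap
  have hTe : ∀ p, D (e p) = e (T p) := fun p => (e.apply_symm_apply _).symm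
  have hT : ∀ X f Y g, T (⁅X, Y⁆, X g - Y f) =
      (⁅(T (X, f)).1, Y⁆ + ⁅X, (T (Y, g)).1⁆,
        (T (X, f)).1 g - Y (T (X, f)).2 + (X (T (Y, g)).2 - (T (Y, g)).1 f)) := by
    intro X f Y g
    apply e.injective
    rw [← hTe, ← he, D.apply_lie_eq_add, hTe, hTe, he, he, ← map_add, add_comm, Prod.mk_add_mk]
  let δ : A →ₗ[ℝ] Derivation ℝ A A := LinearMap.fst ℝ _ _ ∘ₗ T ∘ₗ LinearMap.inr ℝ _ _
  let φ : A →ₗ[ℝ] A := LinearMap.snd ℝ _ _ ∘ₗ T ∘ₗ LinearMap.inr ℝ _ _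
  let γ : Derivation ℝ A A →ₗ[ℝ] A := LinearMap.snd ℝ _ _ ∘ₗ T ∘ₗ LinearMap.inl ℝ _ _
  have hsymm : ∀ f g, δ f g = δ g f := by
    intro f g
    have h := congrArg Prod.snd (hT 0 f 0 g)
    simp only [lie_self, Derivation.coe_zero, Pi.zero_apply, sub_self, Prod.mk_zero_zero,
      map_zero, Prod.snd_zero, sub_zero, zero_sub] at h
    exact (neg_add_eq_zero.1 ((add_comm _ _).trans h.symm)).symm
  have hlie : ∀ (X : Derivation ℝ A A) f, δ (X f) = ⁅X, δ f⁆ := by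
    intro X f
    have h := congrArg Prod.fst (hT X 0 0 f)
    simp only [lie_zero, Derivation.coe_zero, Pi.zero_apply, sub_zero, zero_add] at h
    exact h
  have hδ : δ = 0 := equivariant_symmetric_eq_zero δ hsymm hlie
  have hδ0 : ∀ f, (T (0, f)).1 = 0 := fun f => LinearMap.congr_fun hδ f
  obtain ⟨Z, κ, hZ⟩ := exists_eq_derivation_add_const hA hconst φ (fun X => (T (X, 0)).1) (by
    intro X f
    have h := congrArg Prod.snd (hT X 0 0 f)
    simp only [lie_zero, Derivation.coe_zero, Pi.zero_apply, sub_zero, hδ0] at h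
    exact h)
  have hγ : ∀ X Y, γ ⁅X, Y⁆ = X (γ Y) - Y (γ X) := by
    intro X Y
    have h := congrArg Prod.snd (hT X 0 Y 0)
    simp only [map_zero, sub_zero, zero_sub] at h
    exact h.trans (neg_add_eq_sub _ _)
  obtain ⟨l, hl⟩ := cocycle_smul_eq hA hconst γ hγ
  refine ⟨Z, κ, l, γ, fun X f => ?_, hγ, hl⟩
  rw [hTe, he, ← map_add, Prod.mk_add_mk, map_zero, sub_zero, add_zero]
  congr 1
  have h1 : T (X, f) = T (X, 0) + T (0, f) := by
    rw [← map_add, Prod.mk_add_mk, add_zero, zero_add]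
  have h2 : (T (X, 0)).1 = ⁅Z, X⁆ := by
    ext f
    have h := congrArg Prod.snd (hT X 0 0 f)
    simp only [lie_zero, Derivation.coe_zero, Pi.zero_apply, sub_zero, hδ0] at h
    have h3 : φ (X f) = (T (X, 0)).1 f + X (φ f) := h
    rw [hZ, hZ, map_add, Derivation.map_smul] at h3
    rw [Derivation.commutator_apply]
    linear_combination -h3
  rw [h1]
  refine Prod.ext ?_ ?_
  · rw [Prod.fst_add, h2, hδ0, add_zero]
  · rw [Prod.snd_add, add_comm]
    change φ f + γ X = Z f + (κ • f + γ X)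
    rw [hZ, add_assoc]

end semidirect

/-! ### The Lie algebra of operators of order at most one -/

section operators
variable {n : ℕ} {M : Type*} [TopologicalSpace M]
    [ChartedSpace (EuclideanSpace ℝ (Fin n)) M] [IsManifold (𝓡 n) ∞ M]

namespace FirstOrderDiffOp

theorem mk_add_mk (X Y : SmoothVectorField n M) (f g : SmoothFun n M) :
    mk X f + mk Y g = mk (X + Y) (f + g) := by
  refine Subtype.ext ?_
  change firstOrderOp X f + firstOrderOp Y g = firstOrderOp (X + Y) (f + g)
  ext h x
  simp [firstOrderOp_apply, SmoothVectorField.deriv_apply]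
  ring

set_option synthInstance.maxHeartbeats 200000 in
theorem smul_mk (c : ℝ) (X : SmoothVectorField n M) (f : SmoothFun n M) :
    c • mk X f = mk (c • X) (c • f) := by
  refine Subtype.ext ?_
  change c • firstOrderOp X f = firstOrderOp (c • X) (c • f)
  ext h x
  simp [firstOrderOp_apply, SmoothVectorField.deriv_apply]

theorem lie_mk (X Y : SmoothVectorField n M) (f g : SmoothFun n M) :
    ⁅mk X f, mk Y g⁆ = mk (X.lie Y) (X.deriv g - Y.deriv f) :=
  Subtype.ext (firstOrderOp_lie X Y f g)

theorem mk_inj [T2Space M] {X Y : SmoothVectorField n M} {f g : SmoothFun n M} :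
    mk X f = mk Y g ↔ X = Y ∧ f = g := by
  refine ⟨fun h => ?_, by rintro ⟨rfl, rfl⟩; rfl⟩
  have h1 : ∀ k, X.deriv k + f * k = Y.deriv k + g * k := fun k =>
    LinearMap.congr_fun (congrArg Subtype.val h) k
  have h0 : ∀ Z : SmoothVectorField n M, Z.deriv 1 = 0 := fun Z => Z.toDerivation.map_one_eq_zero
  have h2 : f = g := by simpa [h0] using h1 1
  subst h2
  exact ⟨SmoothVectorField.ext_deriv fun k => add_right_cancel (h1 k), rfl⟩

theorem exists_eq_mk (T : FirstOrderDiffOp n M) : ∃ X f, T = mk X f := by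
  obtain ⟨_, X, f, rfl⟩ := T
  exact ⟨X, f, rfl⟩

end FirstOrderDiffOp

open FirstOrderDiffOp

variable [T2Space M]

/-- The identification of `D¹(M)` with the semidirect product of the derivations of `C^∞(M)` and
`C^∞(M)`, as vector spaces; the bracket is `semidirectEquiv_lie`. -/
noncomputable def semidirectEquiv (n : ℕ) (M : Type*) [TopologicalSpace M]
    [ChartedSpace (EuclideanSpace ℝ (Fin n)) M] [IsManifold (𝓡 n) ∞ M] [T2Space M] :
    (Derivation ℝ (SmoothFun n M) (SmoothFun n M) × SmoothFun n M) ≃ₗ[ℝ] FirstOrderDiffOp n M :=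
  LinearEquiv.ofBijective
    { toFun := fun p => mk (vectorFieldEquiv.symm p.1) p.2
      map_add' := fun p q => by rw [mk_add_mk, ← map_add]; rfl
      map_smul' := fun c p => by rw [RingHom.id_apply, smul_mk, ← map_smul]; rfl }
    ⟨fun p q h => by
      obtain ⟨h1, h2⟩ := mk_inj.1 h
      exact Prod.ext (vectorFieldEquiv.symm.injective h1) h2,
    fun T => by
      obtain ⟨X, f, rfl⟩ := exists_eq_mk T
      exact ⟨(vectorFieldEquiv X, f), congrArg (mk · f) (vectorFieldEquiv.symm_apply_apply X)⟩⟩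

theorem semidirectEquiv_apply (X : Derivation ℝ (SmoothFun n M) (SmoothFun n M))
    (f : SmoothFun n M) : semidirectEquiv n M (X, f) = mk (vectorFieldEquiv.symm X) f := rfl

theorem vectorFieldEquiv_symm_lie (X Y : Derivation ℝ (SmoothFun n M) (SmoothFun n M)) :
    vectorFieldEquiv.symm ⁅X, Y⁆ =
      (vectorFieldEquiv.symm X : SmoothVectorField n M).lie (vectorFieldEquiv.symm Y) := by
  rw [LinearEquiv.symm_apply_eq, vectorFieldEquiv_lie, LinearEquiv.apply_symm_apply,
    LinearEquiv.apply_symm_apply]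

theorem semidirectEquiv_lie (X : Derivation ℝ (SmoothFun n M) (SmoothFun n M))
    (f : SmoothFun n M) (Y : Derivation ℝ (SmoothFun n M) (SmoothFun n M)) (g : SmoothFun n M) :
    ⁅semidirectEquiv n M (X, f), semidirectEquiv n M (Y, g)⁆ =
      semidirectEquiv n M (⁅X, Y⁆, X g - Y f) := by
  simp only [semidirectEquiv_apply, lie_mk, vectorFieldEquiv_symm_lie, vectorFieldEquiv_symm_deriv]

theorem vectorFieldEquiv_symm_smul_apply (f : SmoothFun n M)
    (D : Derivation ℝ (SmoothFun n M) (SmoothFun n M)) (z : M) :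
    (vectorFieldEquiv.symm (f • D) : SmoothVectorField n M) z =
      f z • (vectorFieldEquiv.symm D : SmoothVectorField n M) z := by
  apply tangentVector_ext
  intro g
  rw [← SmoothVectorField.deriv_apply, vectorFieldEquiv_symm_deriv]
  refine Eq.trans ?_ (map_smul (mvfderiv (𝓡 n) g z) (f z) _).symm
  rw [← SmoothVectorField.deriv_apply, vectorFieldEquiv_symm_deriv]
  rfl

/-- The cocycle `X ↦ l div X + w(X)` on the derivations of `C^∞(M)`. -/
noncomputable def divergenceCocycle (η : SmoothDensity n M) (l : ℝ) (w : SmoothOneForm n M) :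
    Derivation ℝ (SmoothFun n M) (SmoothFun n M) →ₗ[ℝ] SmoothFun n M where
  toFun X := l • η.divergence (vectorFieldEquiv.symm X) + w.eval (vectorFieldEquiv.symm X)
  map_add' X Y := by
    rw [map_add, SmoothDensity.divergence_add, SmoothOneForm.eval_add, smul_add]
    abel
  map_smul' c X := by
    rw [map_smul, SmoothDensity.divergence_smul, SmoothOneForm.eval_smul, RingHom.id_apply,
      smul_add, smul_comm]

theorem divergenceCocycle_lie (η : SmoothDensity n M) (l : ℝ) {w : SmoothOneForm n M}
    (hw : w.IsClosed) (X Y : Derivation ℝ (SmoothFun n M) (SmoothFun n M)) :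
    divergenceCocycle η l w ⁅X, Y⁆ =
      X (divergenceCocycle η l w Y) - Y (divergenceCocycle η l w X) := by
  change l • η.divergence (vectorFieldEquiv.symm _) + w.eval (vectorFieldEquiv.symm _) =
    X (l • η.divergence (vectorFieldEquiv.symm _) + w.eval (vectorFieldEquiv.symm _)) -
      Y (l • η.divergence (vectorFieldEquiv.symm _) + w.eval (vectorFieldEquiv.symm _))
  rw [vectorFieldEquiv_symm_lie, η.divergence_lie, w.isClosed_iff.1 hw]
  simp only [vectorFieldEquiv_symm_deriv, map_add, Derivation.map_smul, smul_sub]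
  abel

/-- The derivation `X + f ↦ [Y, X + f] + κ f + l div X + w(X)` of `D¹(M)`. -/
noncomputable def standardDerivation (η : SmoothDensity n M) (Y : SmoothVectorField n M) (κ l : ℝ)
    {w : SmoothOneForm n M} (hw : w.IsClosed) :
    LieDerivation ℝ (FirstOrderDiffOp n M) (FirstOrderDiffOp n M) :=
  LieDerivation.ad ℝ (FirstOrderDiffOp n M) (mk Y 0) +
    outerDerivation (semidirectEquiv n M) semidirectEquiv_lie κ (divergenceCocycle η l w)
      (divergenceCocycle_lie η l hw)

theorem standardDerivation_mk (η : SmoothDensity n M) (Y : SmoothVectorField n M) (κ l : ℝ)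
    {w : SmoothOneForm n M} (hw : w.IsClosed) (X : SmoothVectorField n M) (f : SmoothFun n M) :
    standardDerivation η Y κ l hw (mk X f) =
      ⁅mk Y 0, mk X f⁆ + mk 0 (κ • f + l • η.divergence X + w.eval X) := by
  obtain ⟨X, rfl⟩ := vectorFieldEquiv.symm.surjective X
  rw [standardDerivation, LieDerivation.add_apply, LieDerivation.ad_apply_apply,
    add_assoc (κ • f), ← semidirectEquiv_apply, outerDerivation_apply]
  congr 1
  rw [semidirectEquiv_apply, map_zero]
  rfl

/-- A first-order cocycle with constant symbol `l` differs from `l div` by a closed one-form. -/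
theorem exists_closed_oneForm (η : SmoothDensity n M) (l : ℝ)
    (γ : Derivation ℝ (SmoothFun n M) (SmoothFun n M) →ₗ[ℝ] SmoothFun n M)
    (hγ : ∀ X Y, γ ⁅X, Y⁆ = X (γ Y) - Y (γ X)) (hl : ∀ f X, γ (f • X) = f * γ X + l • X f) :
    ∃ w : SmoothOneForm n M, w.IsClosed ∧
      ∀ X : SmoothVectorField n M, γ (vectorFieldEquiv X) = l • η.divergence X + w.eval X := by
  let α : Derivation ℝ (SmoothFun n M) (SmoothFun n M) →ₗ[SmoothFun n M] SmoothFun n M :=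
    { toFun := fun X => γ X - l • η.divergence (vectorFieldEquiv.symm X)
      map_add' := fun X Y => by
        rw [map_add, map_add, SmoothDensity.divergence_add, smul_add]
        abel
      map_smul' := fun f X => by
        rw [hl, η.divergence_eq_of_eq_smul (vectorFieldEquiv_symm_smul_apply f X),
          vectorFieldEquiv_symm_deriv, RingHom.id_apply, smul_eq_mul, smul_add, mul_sub,
          mul_smul_comm]
        abel }
  obtain ⟨w, hw⟩ := exists_oneForm_eval_eq α
  have hw' : ∀ X : SmoothVectorField n M, w.eval X = γ (vectorFieldEquiv X) - l • η.divergence X := by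
    intro X
    rw [hw]
    change γ (vectorFieldEquiv X) - l • η.divergence (vectorFieldEquiv.symm (vectorFieldEquiv X)) = _
    rw [LinearEquiv.symm_apply_apply]
  refine ⟨w, w.isClosed_iff.2 fun X Y => ?_, fun X => ?_⟩
  · have hd : ∀ (X : SmoothVectorField n M) f, X.deriv f = vectorFieldEquiv X f := fun _ _ => rfl
    rw [hw', hw', hw', vectorFieldEquiv_lie, hγ, η.divergence_lie]
    simp only [hd, map_sub, Derivation.map_smul, smul_sub]
    abel
  · rw [hw']
    abel

/-- Every derivation of `D¹(M)` has the standard form. -/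
theorem exists_standard_form (hn : 1 ≤ n) [SigmaCompactSpace M] [ConnectedSpace M]
    (η : SmoothDensity n M) (D : LieDerivation ℝ (FirstOrderDiffOp n M) (FirstOrderDiffOp n M)) :
    ∃ (Y : SmoothVectorField n M) (κ l : ℝ) (w : SmoothOneForm n M), w.IsClosed ∧
      ∀ (X : SmoothVectorField n M) (f : SmoothFun n M), D (mk X f) =
        ⁅mk Y 0, mk X f⁆ + mk 0 (κ • f + l • η.divergence X + w.eval X) := by
  obtain ⟨Z, κ, l, γ, hD, hγ, hl⟩ := exists_eq_of_lieDerivation (semidirectEquiv n M)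
    (noCommonZeros_smoothFun hn) smoothFun_const_of_derivations semidirectEquiv_lie D
  obtain ⟨w, hwc, hw⟩ := exists_closed_oneForm η l γ hγ hl
  refine ⟨vectorFieldEquiv.symm Z, κ, l, w, hwc, fun X f => ?_⟩
  have h := hD (vectorFieldEquiv X) f
  rwa [semidirectEquiv_apply, semidirectEquiv_apply, semidirectEquiv_apply,
    LinearEquiv.symm_apply_apply, map_zero, hw, ← add_assoc] at h

/-- The values on functions determine `κ`, by `f = 1`, and then `Y`. On the vector fields, replacing
`X` by `f X` isolates `l X(f)`, and `X(f) ≠ 0` for some `X` and `f` because `n ≥ 1`. -/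
theorem standard_form_unique (hn : 1 ≤ n) [SigmaCompactSpace M] [ConnectedSpace M]
    (η : SmoothDensity n M) {Y Y' : SmoothVectorField n M} {κ κ' l l' : ℝ}
    {w w' : SmoothOneForm n M}
    (h : ∀ (X : SmoothVectorField n M) (f : SmoothFun n M),
      ⁅mk Y 0, mk X f⁆ + mk 0 (κ • f + l • η.divergence X + w.eval X) =
      ⁅mk Y' 0, mk X f⁆ + mk 0 (κ' • f + l' • η.divergence X + w'.eval X)) :
    Y = Y' ∧ κ = κ' ∧ l = l' ∧ w = w' := by
  simp only [lie_mk, mk_add_mk, add_zero, mk_inj] at h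
  have hz : ∀ X : SmoothVectorField n M, X.deriv 0 = 0 := fun X => map_zero X.toEnd
  have h1 : ∀ X : SmoothVectorField n M, X.deriv 1 = 0 := fun X => X.toDerivation.map_one_eq_zero
  have hf : ∀ f, Y.deriv f + κ • f = Y'.deriv f + κ' • f := by
    intro f
    have h2 := (h 0 f).2
    have h3 := (h 0 0).2
    simp only [hz, smul_zero] at h2 h3
    linear_combination h2 - h3
  obtain ⟨x⟩ := (inferInstance : Nonempty M)
  have hκ : κ = κ' := by
    have h2 := hf 1
    rw [h1, h1, zero_add, zero_add] at h2
    have h3 := congrArg (fun g : SmoothFun n M => g x) h2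
    simpa using h3
  subst hκ
  have hY : Y = Y' := SmoothVectorField.ext_deriv fun f => add_right_cancel (hf f)
  subst hY
  have hX : ∀ X, l • η.divergence X + w.eval X = l' • η.divergence X + w'.eval X := by
    intro X
    have h2 := (h X 0).2
    simpa [hz, add_assoc] using h2
  have hl : l = l' := by
    by_contra hne
    have hD : ∀ (X : SmoothVectorField n M) f, X.deriv f = 0 := by
      intro X f
      have hfX : ∀ z, (vectorFieldEquiv.symm (f • vectorFieldEquiv X) : SmoothVectorField n M) z =
          f z • X z := by
        intro z
        rw [vectorFieldEquiv_symm_smul_apply, LinearEquiv.symm_apply_apply]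
      have h2 := hX (vectorFieldEquiv.symm (f • vectorFieldEquiv X))
      rw [η.divergence_eq_of_eq_smul hfX, w.eval_eq_of_eq_smul hfX, w'.eval_eq_of_eq_smul hfX] at h2
      have h3 : (l - l') • X.deriv f = 0 := by
        simp only [smul_add, ← mul_smul_comm] at h2
        rw [sub_smul]
        linear_combination h2 - f * hX X
      exact (smul_eq_zero.1 h3).resolve_left (sub_ne_zero.2 hne)
    obtain ⟨k₁, k₂, hk⟩ := exists_pair_no_common_critical_point (M := M) hn
    rcases hk x with ⟨v, hv⟩ | ⟨v, hv⟩ <;>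
    · obtain ⟨X, rfl⟩ := exists_smoothVectorField_apply_eq x v
      exact hv (congrArg (fun g : SmoothFun n M => g x) (hD X _))
  subst hl
  exact ⟨rfl, rfl, rfl, SmoothOneForm.ext_eval fun X => add_left_cancel (hX X)⟩

end operators

theorem theorem1 (n : ℕ) (hn : 1 ≤ n) (M : Type*) [TopologicalSpace M]
    [ChartedSpace (EuclideanSpace ℝ (Fin n)) M] [IsManifold (𝓡 n) ∞ M]
    [T2Space M] [SecondCountableTopology M] [ConnectedSpace M] (η : SmoothDensity n M) :
    -- a map is a derivation if and only if it has the stated form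
    (∀ C : FirstOrderDiffOp n M → FirstOrderDiffOp n M,
      (∃ D : LieDerivation ℝ (FirstOrderDiffOp n M) (FirstOrderDiffOp n M), ⇑D = C) ↔
        ∃ (Y : SmoothVectorField n M) (κ l : ℝ) (w : SmoothOneForm n M), w.IsClosed ∧
          ∀ (X : SmoothVectorField n M) (f : SmoothFun n M),
            C (FirstOrderDiffOp.mk X f) =
              ⁅FirstOrderDiffOp.mk Y 0, FirstOrderDiffOp.mk X f⁆ +
                FirstOrderDiffOp.mk 0 (κ • f + l • η.divergence X + w.eval X)) ∧
    -- all choices of the data define such a map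
    (∀ (Y : SmoothVectorField n M) (κ l : ℝ) (w : SmoothOneForm n M), w.IsClosed →
      ∃ C : FirstOrderDiffOp n M → FirstOrderDiffOp n M,
        ∀ (X : SmoothVectorField n M) (f : SmoothFun n M),
          C (FirstOrderDiffOp.mk X f) =
            ⁅FirstOrderDiffOp.mk Y 0, FirstOrderDiffOp.mk X f⁆ +
              FirstOrderDiffOp.mk 0 (κ • f + l • η.divergence X + w.eval X)) ∧
    -- the map determines the data
    (∀ (C : FirstOrderDiffOp n M → FirstOrderDiffOp n M)
      (Y Y' : SmoothVectorField n M) (κ κ' l l' : ℝ) (w w' : SmoothOneForm n M),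
      w.IsClosed → w'.IsClosed →
      (∀ (X : SmoothVectorField n M) (f : SmoothFun n M),
        C (FirstOrderDiffOp.mk X f) =
          ⁅FirstOrderDiffOp.mk Y 0, FirstOrderDiffOp.mk X f⁆ +
            FirstOrderDiffOp.mk 0 (κ • f + l • η.divergence X + w.eval X)) →
      (∀ (X : SmoothVectorField n M) (f : SmoothFun n M),
        C (FirstOrderDiffOp.mk X f) =
          ⁅FirstOrderDiffOp.mk Y' 0, FirstOrderDiffOp.mk X f⁆ +
            FirstOrderDiffOp.mk 0 (κ' • f + l' • η.divergence X + w'.eval X)) →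
      Y = Y' ∧ κ = κ' ∧ l = l' ∧ w = w') := by
  have : LocallyCompactSpace M := ChartedSpace.locallyCompactSpace (EuclideanSpace ℝ (Fin n)) M
  refine ⟨fun C => ⟨?_, ?_⟩, fun Y κ l w hw => ?_, fun C Y Y' κ κ' l l' w w' _ _ h h' => ?_⟩
  · rintro ⟨D, rfl⟩
    exact exists_standard_form hn η D
  · rintro ⟨Y, κ, l, w, hw, hC⟩
    refine ⟨standardDerivation η Y κ l hw, funext fun T => ?_⟩
    obtain ⟨X, f, rfl⟩ := FirstOrderDiffOp.exists_eq_mk T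
    rw [hC, standardDerivation_mk]
  · exact ⟨standardDerivation η Y κ l hw, standardDerivation_mk η Y κ l hw⟩
  · exact standard_form_unique hn η fun X f => (h X f).symm.trans (h' X f)
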